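/- Let $k$ be a field, $r\ge 0$, $S=k[x_1,\dots,x_r]$ with its $\mathbb{Z}^r$-grading ($\deg x_i$ is the $i$-th unit vector), and let $E=\bigoplus_{\underline n\in\mathbb{Z}^r}E_{\underline n}$ be a finitely generated $\mathbb{Z}^r$-graded $S$-module. Put $\bar{\mathbb{Z}}=\mathbb{Z}\cup\{-\infty\}$ and order $\bar{\mathbb{Z}}^r$ componentwise. Elements of $\bar{\mathbb{Z}}^r\setminus\mathbb{Z}^r$ are called infinitary; set $E_{\underline n}=0$ for these. For $\underline n\le\underline n'$ let $\chi_{\underline n,\underline n'}\colon E_{\underline n}\to E_{\underline n'}$ be multiplication by $x^{\underline n'-\underline n}$ (zero if $\underline n$ is infinitary). For $\underline n\in\mathbb{Z}^r$ let $I_E(\underline n)$ be the set of the minimal elements among those $\underline n'\le\underline n$ in $\bar{\mathbb{Z}}^r$ such that $\chi_{\underline n',\underline n''}$ and $\chi_{\underline n'',\underline n}$ are isomorphisms for all $\underline n''\in\bar{\mathbb{Z}}^r$ with $\underline n'\le\underline n''\le\underline n$. Let $\mathcal{L}_E$ (the lcm-lattice of $E$) consist of $\hat 0=(-\infty,\dots,-\infty)$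 and of all componentwise maxima of nonempty finite subsets of $\bigcup_{\underline n\in\mathbb{Z}^r}I_E(\underline n)$ that lie in $\mathbb{Z}^r$. Every $\underline n\in\mathbb{Z}^r$ has an anchor element $A_E(\underline n)$, the greatest element of $\mathcal{L}_E$ that is $\le\underline n$. A representation of a poset $\mathcal{P}$ is a functor from $\mathcal{P}$ to $k$-vector spaces. For $x\in\mathcal{P}$ let $F^x$ be the representation with $F^x_y=k$ for $y\ge x$ and $F^x_y=0$ otherwise, with identity maps between the places $y\ge x$. The free dimension of a representation $V$ at $x$ is $\dim_k\big(V_x/\sum_{y<x}V(y,x)V_y\big)$. Let $\operatorname{zip}(E)$ be the representation $\underline n\mapsto E_{\underline n}$, with the maps $\chi$, of $\mathcal{L}_E$. For a representation $F$ of $\mathcal{L}_E$ let $\operatorname{unzip}(F)$ be the $\mathbb{Z}^r$-graded $S$-module with $\operatorname{unzip}(F)_{\underline n}=F_{A_E(\underline n)}$, on which the monomial $x^{\underline m}$ acts in degree $\underline n$ by the map $F(A_E(\underline n),A_E(\underline n+\underline m))$. Then $\operatorname{zip}(E)$ has a free resolution over $\mathcal{L}_E$, that is, an exact sequence of representations $$\cdots\longrightarrow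 F_1\longrightarrow F_0\longrightarrow\operatorname{zip}(E)\longrightarrow 0,\qquad F_i\cong\bigoplus_{\underline n\in\mathcal{L}_E}(F^{\underline n})^{f^i_{\underline n}}\quad(i\ge 0),$$ where $f^i_{\underline n}$ is the free dimension at $\underline n$ of the $(i-1)$-th syzygy representation, which is $\operatorname{zip}(E)$ for $i=0$, $\ker(F_0\to\operatorname{zip}(E))$ for $i=1$, and $\ker(F_{i-1}\to F_{i-2})$ for $i\ge 2$. For every such resolution, the unzipped sequence $$\cdots\longrightarrow\operatorname{unzip}(F_1)\longrightarrow\operatorname{unzip}(F_0)\longrightarrow E\longrightarrow 0,$$ whose last map is the composite of $\operatorname{unzip}(F_0)\to\operatorname{unzip}(\operatorname{zip}(E))$ with the map $\operatorname{unzip}(\operatorname{zip}(E))\to E$ given in degree $\underline n$ by $\chi_{A_E(\underline n),\underline n}$, is a minimal $\mathbb{Z}^r$-graded free resolution of $E$ of finite length: it is exact, all its maps are homogeneous of degree $0$, the modules $\operatorname{unzip}(F_i)$ are free of finite rank and vanish for all large $i$, and the image of $\operatorname{unzip}(F_{i+1})\to\operatorname{unzip}(F_i)$ lies in $(x_1,\dots,x_r)\operatorname{unzip}(F_i)$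 for all $i\ge 0$. Moreover $f^i_{\underline n}=0$ for all infinitary $\underline n\in\mathcal{L}_E$, and there are isomorphisms of graded $S$-modules $$\operatorname{unzip}(F_i)\cong\bigoplus_{\underline n\in\mathcal{L}_E\cap\mathbb{Z}^r}S(-\underline n)^{f^i_{\underline n}}\qquad(i\ge 0).$$ -/

import Mathlib

open CategoryTheory

universe u

set_option linter.unusedSectionVars false

noncomputable section

namespace LcmResolution

/-! ### Representations of posets

A `k`-linear representation of a poset `P` is a functor `P ⥤ ModuleCat k`, where `P` is regarded as
a category through its order. -/

section Representations

variable {k : Type u} [Field k] {P : Type} [PartialOrder P]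

/-- The free representation `⨁ j, F^{x j}`, where `F^x` is `k` in the places `y ≥ x`, zero in all
other places, and its maps between places `≥ x` are identities. In the place `y` the direct sum is
`⨁_{j : x j ≤ y} k`, the space of finitely supported functions `J → k` that vanish at all `j` with
`¬ x j ≤ y`; its maps are the inclusions. -/
def freeRepOn (k : Type u) [Field k] {J : Type} (x : J → P) : P ⥤ ModuleCat.{u} k where
  obj y := ModuleCat.of k (Finsupp.supported k k {j | x j ≤ y})
  map {_ _} h := ModuleCat.ofHom
    (Submodule.inclusion (Finsupp.supported_mono fun _ hj => le_trans hj (leOfHom h)))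
  map_id _ := rfl
  map_comp _ _ := rfl

/-- The free representation `⨁ x, (F^x)^{f x}`. -/
def freeRep (k : Type u) [Field k] (f : P → ℕ) : P ⥤ ModuleCat.{u} k :=
  freeRepOn k (fun j : (Σ x : P, Fin (f x)) => j.1)

/-- The subspace `V_{<x} = ∑_{y < x} V(y, x) V_y` of `V_x`. -/
def lowerPart (V : P ⥤ ModuleCat.{u} k) (x : P) : Submodule k (V.obj x) :=
  ⨆ (y : P) (h : y < x), LinearMap.range (V.map (homOfLE h.le)).hom

/-- The free dimension of `V` in the place `x`: the codimension of `V_{<x}` in `V_x`. -/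
def freeDim (V : P ⥤ ModuleCat.{u} k) (x : P) : ℕ :=
  Module.finrank k (V.obj x ⧸ lowerPart V x)

/-- The kernel of a morphism of representations. -/
def kerRep {V W : P ⥤ ModuleCat.{u} k} (φ : V ⟶ W) : P ⥤ ModuleCat.{u} k where
  obj x := ModuleCat.of k (LinearMap.ker (φ.app x).hom)
  map {x y} h := ModuleCat.ofHom <| (V.map h).hom.restrict fun v hv => by
    have := congrArg (fun g => g.hom v) (φ.naturality h)
    simp only [ModuleCat.hom_comp, LinearMap.comp_apply] at this
    rw [LinearMap.mem_ker] at hv ⊢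
    rw [this, hv, map_zero]
  map_id x := by
    refine ModuleCat.hom_ext (LinearMap.ext fun v => Subtype.ext ?_)
    change (V.map (𝟙 x)).hom v.1 = v.1
    simp
  map_comp f g := by
    refine ModuleCat.hom_ext (LinearMap.ext fun v => Subtype.ext ?_)
    change (V.map (f ≫ g)).hom v.1 = (V.map g).hom ((V.map f).hom v.1)
    simp

/-- In a sequence `⋯ ⟶ F 1 ⟶ F 0 ⟶ V` of representations: `V` itself, the kernel of `F 0 ⟶ V`,
and then the kernels of the maps `F (i + 1) ⟶ F i`. So the value at `i` is the representation that
`F i` has to cover, the `(i - 1)`-th syzygy representation. -/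
def syzygy {V : P ⥤ ModuleCat.{u} k} {F : ℕ → (P ⥤ ModuleCat.{u} k)}
    (d : ∀ i, F (i + 1) ⟶ F i) (ε : F 0 ⟶ V) : ℕ → (P ⥤ ModuleCat.{u} k)
  | 0 => V
  | 1 => kerRep ε
  | i + 2 => kerRep (d i)

/-- The multiplicities `f^i_x`: the free dimension of the `(i - 1)`-th syzygy in the place `x`. -/
def multiplicity {V : P ⥤ ModuleCat.{u} k} {F : ℕ → (P ⥤ ModuleCat.{u} k)}
    (d : ∀ i, F (i + 1) ⟶ F i) (ε : F 0 ⟶ V) (i : ℕ) (x : P) : ℕ :=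
  freeDim (syzygy d ε i) x

/-- `⋯ ⟶ F 1 ⟶ F 0 ⟶ V ⟶ 0` is a resolution of `V` by free representations
`F i ≅ ⨁ x, (F^x)^{f^i_x}`, where `f^i_x` is the free dimension of the `(i - 1)`-th syzygy
representation in the place `x`. -/
structure IsFreeResolution {V : P ⥤ ModuleCat.{u} k} {F : ℕ → (P ⥤ ModuleCat.{u} k)}
    (d : ∀ i, F (i + 1) ⟶ F i) (ε : F 0 ⟶ V) : Prop where
  surjective : ∀ x, Function.Surjective (ε.app x).hom
  exact_zero : ∀ x, Function.Exact ((d 0).app x).hom (ε.app x).hom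
  exact_succ : ∀ i x, Function.Exact ((d (i + 1)).app x).hom ((d i).app x).hom
  free : ∀ i, Nonempty (F i ≅ freeRep k (multiplicity d ε i))

end Representations

/-! ### Lcm-lattices -/

section LcmLattice

variable {r : ℕ}

/-- `ℤ^r` with the componentwise order, as a category. -/
instance degCategory (r : ℕ) : SmallCategory (Fin r → ℤ) := Preorder.smallCategory _

/-- `(ℤ ∪ {-∞})^r` with the componentwise order, as a category. -/
instance extDegCategory (r : ℕ) : SmallCategory (Fin r → WithBot ℤ) := Preorder.smallCategory _

/-- The inclusion of `ℤ^r` into `(ℤ ∪ {-∞})^r`; the elements outside its image are the infinitary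
ones. -/
def emb (n : Fin r → ℤ) : Fin r → WithBot ℤ := fun i => (n i : WithBot ℤ)

theorem emb_le {m n : Fin r → ℤ} : emb m ≤ emb n ↔ m ≤ n := by
  simp [emb, Pi.le_def]

theorem emb_injective : Function.Injective (emb : (Fin r → ℤ) → Fin r → WithBot ℤ) :=
  fun _ _ h => funext fun i => WithBot.coe_injective (congrFun h i)

theorem emb_mono : Monotone (emb : (Fin r → ℤ) → Fin r → WithBot ℤ) := fun _ _ h => emb_le.2 h

theorem eq_emb_of_emb_le {m : Fin r → ℤ} {n : Fin r → WithBot ℤ} (h : emb m ≤ n) :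
    n ∈ Set.range (emb : (Fin r → ℤ) → _) := by
  have : ∀ i, ∃ z : ℤ, (z : WithBot ℤ) = n i := fun i => by
    have hi : n i ≠ ⊥ := fun hb => by
      have := h i
      rw [hb, le_bot_iff] at this
      exact WithBot.coe_ne_bot this
    exact WithBot.ne_bot_iff_exists.1 hi
  choose z hz using this
  exact ⟨z, funext hz⟩

/-- The lcm-lattice of `P ⊆ (ℤ ∪ {-∞})^r`: all least common multiples (componentwise maxima) of
nonempty finite subsets of `P` that lie in `ℤ^r`, together with `(-∞, …, -∞)`. -/
def lcmLattice (P : Set (Fin r → WithBot ℤ)) : Set (Fin r → WithBot ℤ) :=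
  (supClosure P ∩ Set.range emb) ∪ {⊥}

theorem sup_mem_lcmLattice {P : Set (Fin r → WithBot ℤ)} {a b : Fin r → WithBot ℤ}
    (ha : a ∈ lcmLattice P) (hb : b ∈ lcmLattice P) : a ⊔ b ∈ lcmLattice P := by
  rcases ha with ⟨ha, m, rfl⟩ | rfl
  · rcases hb with ⟨hb, n, rfl⟩ | rfl
    · exact Or.inl ⟨supClosed_supClosure ha hb, eq_emb_of_emb_le le_sup_left⟩
    · exact Or.inl ⟨by simpa using ha, m, by simp⟩
  · simpa using hb

/-- Every `n ∈ ℤ^r` has a unique maximal lower bound in an lcm-lattice. -/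
theorem exists_anchor (P : Set (Fin r → WithBot ℤ)) (n : Fin r → ℤ) :
    ∃ a, IsGreatest {l | l ∈ lcmLattice P ∧ l ≤ emb n} a := by
  classical
  -- the gap between an element below `n` and `n`, with an infinitary coordinate counted as largest
  let gap : (Fin r → WithBot ℤ) → Fin r → ℕ∞ := fun l i =>
    WithBot.recBotCoe (⊤ : ℕ∞) (fun z => (((n i - z).toNat : ℕ) : ℕ∞)) (l i)
  have hne : {l | l ∈ lcmLattice P ∧ l ≤ emb n}.Nonempty := ⟨⊥, Or.inr rfl, bot_le⟩
  obtain ⟨a, ha, hmin⟩ := WellFounded.has_min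
    (InvImage.wf gap (wellFounded_lt (α := Fin r → ℕ∞))) _ hne
  refine ⟨a, ha, fun b hb => ?_⟩
  have hab : a ⊔ b ∈ {l | l ∈ lcmLattice P ∧ l ≤ emb n} :=
    ⟨sup_mem_lcmLattice ha.1 hb.1, sup_le ha.2 hb.2⟩
  have key : ∀ l l' : Fin r → WithBot ℤ, l ≤ l' → l' ≤ emb n → ∀ i,
      gap l' i ≤ gap l i ∧ (gap l i ≤ gap l' i → l' i ≤ l i) := by
    intro l l' h h' i
    have h1 := h i
    have h2 := h' i
    simp only [gap, emb] at *
    generalize l i = x at *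
    generalize l' i = y at *
    induction x using WithBot.recBotCoe with
    | bot =>
      induction y using WithBot.recBotCoe with
      | bot => simp
      | coe y => simp
    | coe x =>
      induction y using WithBot.recBotCoe with
      | bot => simp at h1
      | coe y =>
        simp only [WithBot.coe_le_coe, WithBot.recBotCoe_coe, Nat.cast_le] at *
        omega
  have hk := key a (a ⊔ b) le_sup_left hab.2
  by_contra hba
  refine hmin _ hab (lt_of_le_of_ne (fun i => (hk i).1) fun he => hba ?_)
  have : a ⊔ b ≤ a := fun i => (hk i).2 (le_of_eq (congrFun he i).symm)
  exact le_trans le_sup_right this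

/-- The anchor element `A(n)` of `n ∈ ℤ^r` in an lcm-lattice: its greatest element `≤ n`. -/
def anchor (P : Set (Fin r → WithBot ℤ)) (n : Fin r → ℤ) : lcmLattice P :=
  ⟨(exists_anchor P n).choose, (exists_anchor P n).choose_spec.1.1⟩

theorem anchor_le (P : Set (Fin r → WithBot ℤ)) (n : Fin r → ℤ) :
    (anchor P n : Fin r → WithBot ℤ) ≤ emb n :=
  (exists_anchor P n).choose_spec.1.2

theorem le_anchor {P : Set (Fin r → WithBot ℤ)} {n : Fin r → ℤ} {l : lcmLattice P}
    (h : (l : Fin r → WithBot ℤ) ≤ emb n) : l ≤ anchor P n :=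
  (exists_anchor P n).choose_spec.2 ⟨l.2, h⟩

theorem anchor_mono (P : Set (Fin r → WithBot ℤ)) : Monotone (anchor P) := fun m _ h =>
  le_anchor ((anchor_le P m).trans (emb_mono h))

end LcmLattice

/-! ### The initial elements of a representation of `(ℤ ∪ {-∞})^r` -/

section Initial

variable {k : Type u} [Field k] {r : ℕ}

/-- `n' ≤ n`, and for all `n' ≤ n'' ≤ n` the maps `V_{n'} → V_{n''}` and `V_{n''} → V_n` are
isomorphisms. -/
def IsIsoInterval (V : (Fin r → WithBot ℤ) ⥤ ModuleCat.{u} k) (n n' : Fin r → WithBot ℤ) : Prop :=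
  n' ≤ n ∧ ∀ (n'' : Fin r → WithBot ℤ) (h : n' ≤ n'') (h' : n'' ≤ n),
    IsIso (V.map (homOfLE h)) ∧ IsIso (V.map (homOfLE h'))

/-- The set `I(n)` of all `n'` that are minimal with the property `IsIsoInterval V n n'`. -/
def initialAt (V : (Fin r → WithBot ℤ) ⥤ ModuleCat.{u} k) (n : Fin r → ℤ) :
    Set (Fin r → WithBot ℤ) :=
  {n' | Minimal (IsIsoInterval V (emb n)) n'}

/-- The union of the sets `I(n)` over all `n ∈ ℤ^r`. -/
def initialSet (V : (Fin r → WithBot ℤ) ⥤ ModuleCat.{u} k) : Set (Fin r → WithBot ℤ) :=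
  ⋃ n : Fin r → ℤ, initialAt V n

end Initial

/-! ### Graded modules over the polynomial ring -/

section Graded

variable {k : Type u} [Field k] {r : ℕ}

/-- The part `S_n` of degree `n ∈ ℤ^r` of the fine-graded polynomial ring `S = k[x_1, …, x_r]`, in
which `x_i` has degree the `i`-th unit vector. -/
abbrev polyPart (k : Type u) [Field k] (r : ℕ) (n : Fin r → ℤ) :
    Submodule k (MvPolynomial (Fin r) k) :=
  MvPolynomial.weightedHomogeneousSubmodule k (fun i : Fin r => (Pi.single i 1 : Fin r → ℤ)) n

/-- The degree in `ℤ^r` of the monomial `x^w`. -/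
def monDeg (w : Fin r →₀ ℕ) : Fin r → ℤ := fun i => (w i : ℤ)

theorem monDeg_nonneg (w : Fin r →₀ ℕ) : 0 ≤ monDeg w := fun i => Int.natCast_nonneg (w i)

theorem le_add_monDeg (n : Fin r → ℤ) (w : Fin r →₀ ℕ) : n ≤ n + monDeg w :=
  le_add_of_nonneg_right (monDeg_nonneg w)

theorem monDeg_zero : monDeg (0 : Fin r →₀ ℕ) = 0 := rfl

theorem monDeg_add (v w : Fin r →₀ ℕ) : monDeg (v + w) = monDeg v + monDeg w := by
  funext i
  simp [monDeg]

theorem monomial_mem_polyPart (w : Fin r →₀ ℕ) :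
    (MvPolynomial.monomial w (1 : k)) ∈ polyPart k r (monDeg w) := by
  rw [MvPolynomial.mem_weightedHomogeneousSubmodule]
  refine MvPolynomial.isWeightedHomogeneous_monomial _ _ _ ?_
  funext j
  rw [Finsupp.weight_apply, Finsupp.sum_fintype _ _ (by simp)]
  simp [monDeg, Finset.sum_apply, Pi.single_apply]

/-- Multiplication by the monomial `x^w`. -/
def mulMonomial (k : Type u) [Field k] {r : ℕ} (E : Type u) [AddCommGroup E] [Module k E]
    [Module (MvPolynomial (Fin r) k) E] [IsScalarTower k (MvPolynomial (Fin r) k) E]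
    (w : Fin r →₀ ℕ) : E →ₗ[k] E :=
  (LinearMap.lsmul (MvPolynomial (Fin r) k) E (MvPolynomial.monomial w 1)).restrictScalars k

theorem linear_of_monomial {M N : Type u} [AddCommGroup M] [Module k M]
    [Module (MvPolynomial (Fin r) k) M] [IsScalarTower k (MvPolynomial (Fin r) k) M]
    [AddCommGroup N] [Module k N]
    [Module (MvPolynomial (Fin r) k) N] [IsScalarTower k (MvPolynomial (Fin r) k) N]
    (f : M →ₗ[k] N)
    (hf : ∀ (w : Fin r →₀ ℕ) (m : M), f (MvPolynomial.monomial w (1 : k) • m) =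
      MvPolynomial.monomial w (1 : k) • f m)
    (p : MvPolynomial (Fin r) k) (m : M) : f (p • m) = p • f m := by
  induction p using MvPolynomial.induction_on' with
  | monomial w a =>
    have : MvPolynomial.monomial w a = a • MvPolynomial.monomial w (1 : k) := by
      simp [MvPolynomial.smul_monomial]
    rw [this, smul_assoc, map_smul, hf, smul_assoc]
  | add p q hp hq => rw [add_smul, map_add, hp, hq, add_smul]

/-! #### From representations of `ℤ^r` to graded modules -/

/-- The `ℤ^r`-graded module `⨁ n, V_n` over `S` that corresponds to a representation `V` of
`ℤ^r`. -/
def GradedOf (V : (Fin r → ℤ) ⥤ ModuleCat.{u} k) : Type u :=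
  DirectSum (Fin r → ℤ) fun n => V.obj n

namespace GradedOf

variable (V W : (Fin r → ℤ) ⥤ ModuleCat.{u} k)

instance : AddCommGroup (GradedOf V) :=
  inferInstanceAs (AddCommGroup (DirectSum (Fin r → ℤ) fun n => V.obj n))

instance : Module k (GradedOf V) :=
  inferInstanceAs (Module k (DirectSum (Fin r → ℤ) fun n => V.obj n))

/-- The inclusion of `V_n`. -/
def incl (n : Fin r → ℤ) : V.obj n →ₗ[k] GradedOf V :=
  DirectSum.lof k (Fin r → ℤ) (fun n => V.obj n) n

/-- The homogeneous part of degree `n`. -/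
def part (n : Fin r → ℤ) : Submodule k (GradedOf V) := LinearMap.range (incl V n)

variable {V W} in
/-- The linear map out of `⨁ n, V_n` with given components. -/
def desc {N : Type u} [AddCommGroup N] [Module k N] (f : ∀ n, V.obj n →ₗ[k] N) :
    GradedOf V →ₗ[k] N :=
  DirectSum.toModule k (Fin r → ℤ) N f

variable {V W} in
theorem desc_incl {N : Type u} [AddCommGroup N] [Module k N] (f : ∀ n, V.obj n →ₗ[k] N)
    (n : Fin r → ℤ) (v : V.obj n) : desc f (incl V n v) = f n v := by
  unfold desc incl
  exact DirectSum.toModule_lof (M := fun n => V.obj n) (φ := f) k n v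

variable {V W} in
theorem hom_ext {N : Type u} [AddCommGroup N] [Module k N] {f g : GradedOf V →ₗ[k] N}
    (h : ∀ n v, f (incl V n v) = g (incl V n v)) : f = g :=
  DirectSum.linearMap_ext k fun n => LinearMap.ext fun v => h n v

/-- The action of the monomial `x^w` on `⨁ n, V_n`: the maps `V_n → V_{n + w}` of `V`. -/
def shift (w : Fin r →₀ ℕ) : GradedOf V →ₗ[k] GradedOf V :=
  desc fun n => incl V (n + monDeg w) ∘ₗ (V.map (homOfLE (le_add_monDeg n w))).hom

theorem shift_incl (w : Fin r →₀ ℕ) (n : Fin r → ℤ) (v : V.obj n) :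
    shift V w (incl V n v) =
      incl V (n + monDeg w) ((V.map (homOfLE (le_add_monDeg n w))).hom v) :=
  desc_incl _ n v

theorem incl_map_congr {n m m' : Fin r → ℤ} (e : m = m') (h : n ≤ m) (h' : n ≤ m')
    (v : V.obj n) :
    incl V m ((V.map (homOfLE h)).hom v) = incl V m' ((V.map (homOfLE h')).hom v) := by
  subst e
  rfl

theorem shift_zero : shift V 0 = LinearMap.id := by
  refine hom_ext fun n v => ?_
  rw [shift_incl, incl_map_congr V (by rw [monDeg_zero, add_zero]) _ le_rfl]
  have : V.map (homOfLE (le_refl n)) = 𝟙 _ := V.map_id n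
  rw [this]
  rfl

theorem shift_add (w w' : Fin r →₀ ℕ) : shift V (w + w') = shift V w ∘ₗ shift V w' := by
  refine hom_ext fun n v => ?_
  rw [LinearMap.comp_apply, shift_incl, shift_incl, shift_incl,
    ← LinearMap.comp_apply (V.map _).hom, ← ModuleCat.hom_comp, ← V.map_comp]
  exact incl_map_congr V (by rw [monDeg_add, add_assoc, add_comm (monDeg w)]) _ _ v

/-- The action of `S` on `⨁ n, V_n`. -/
def action : MvPolynomial (Fin r) k →ₐ[k] Module.End k (GradedOf V) :=
  AddMonoidAlgebra.lift k (Module.End k (GradedOf V)) (Fin r →₀ ℕ)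
    { toFun := fun w => shift V (Multiplicative.toAdd w)
      map_one' := shift_zero V
      map_mul' := fun w w' => shift_add V (Multiplicative.toAdd w) (Multiplicative.toAdd w') }

instance : Module (MvPolynomial (Fin r) k) (GradedOf V) :=
  Module.compHom (GradedOf V) (action V).toRingHom

theorem smul_def (p : MvPolynomial (Fin r) k) (x : GradedOf V) : p • x = action V p x := rfl

instance : IsScalarTower k (MvPolynomial (Fin r) k) (GradedOf V) where
  smul_assoc a p x := by
    rw [smul_def, smul_def, map_smul]
    rfl

theorem monomial_smul (w : Fin r →₀ ℕ) (x : GradedOf V) :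
    MvPolynomial.monomial w (1 : k) • x = shift V w x := by
  rw [smul_def]
  change action V (AddMonoidAlgebra.single w 1) x = _
  simp [action]

variable {V W} in
/-- The homomorphism of graded `S`-modules that corresponds to a morphism of representations. -/
def map (φ : V ⟶ W) : GradedOf V →ₗ[MvPolynomial (Fin r) k] GradedOf W :=
  let f : GradedOf V →ₗ[k] GradedOf W := desc fun n => incl W n ∘ₗ (φ.app n).hom
  { toFun := f
    map_add' := map_add f
    map_smul' := linear_of_monomial f fun w x => by
      rw [monomial_smul, monomial_smul, ← LinearMap.comp_apply, ← LinearMap.comp_apply]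
      congr 1
      refine hom_ext fun n v => ?_
      have := congrArg (fun g => g.hom v) (φ.naturality (homOfLE (le_add_monDeg n w)))
      simp only [ModuleCat.hom_comp, LinearMap.comp_apply] at this
      simp only [f, LinearMap.comp_apply, shift_incl, desc_incl, this] }

end GradedOf

/-! #### From graded modules to representations -/

variable {E : Type u} [AddCommGroup E] [Module k E] [Module (MvPolynomial (Fin r) k) E]
  (ℳ : (Fin r → ℤ) → Submodule k E)

/-- `E_n` for `n ∈ (ℤ ∪ {-∞})^r`: the part of degree `n` if `n ∈ ℤ^r`, and `0` if `n` is
infinitary. -/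
def extPart (n : Fin r → WithBot ℤ) : Submodule k E :=
  ⨆ (m : Fin r → ℤ) (_ : emb m = n), ℳ m

theorem extPart_emb (m : Fin r → ℤ) : extPart ℳ (emb m) = ℳ m := by
  apply le_antisymm
  · exact iSup₂_le fun m' h => by rw [emb_injective h]
  · exact le_iSup₂_of_le m rfl le_rfl

theorem extPart_infinitary {n : Fin r → WithBot ℤ} (h : n ∉ Set.range emb) :
    extPart ℳ n = ⊥ :=
  le_bot_iff.1 <| iSup₂_le fun m hm => absurd ⟨m, hm⟩ h

/-- The exponent `n' - n` for `n ≤ n'` in `ℤ^r` (its value at infinitary elements is not used). -/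
def expo (n n' : Fin r → WithBot ℤ) : Fin r →₀ ℕ :=
  Finsupp.equivFunOnFinite.symm fun i => ((n' i).unbotD 0 - (n i).unbotD 0).toNat

theorem expo_self (n : Fin r → WithBot ℤ) : expo n n = 0 := by
  ext i
  simp [expo]

theorem monDeg_expo {m m' : Fin r → ℤ} (h : m ≤ m') : m + monDeg (expo (emb m) (emb m')) = m' := by
  funext i
  have := h i
  simp [monDeg, expo, emb, this]

theorem expo_add {m m' m'' : Fin r → ℤ} (h : m ≤ m') (h' : m' ≤ m'') :
    expo (emb m') (emb m'') + expo (emb m) (emb m') = expo (emb m) (emb m'') := by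
  ext i
  have h1 : m i ≤ m' i := h i
  have h2 : m' i ≤ m'' i := h' i
  simp only [expo, emb, Finsupp.coe_add, Pi.add_apply, Finsupp.equivFunOnFinite_symm_apply_apply,
    WithBot.unbotD_coe]
  omega

variable [IsScalarTower k (MvPolynomial (Fin r) k) E] [SetLike.GradedSMul (polyPart k r) ℳ]

theorem mulMonomial_mem {n n' : Fin r → WithBot ℤ} (h : n ≤ n') (e : E) (he : e ∈ extPart ℳ n) :
    mulMonomial k E (expo n n') e ∈ extPart ℳ n' := by
  by_cases hn : n ∈ Set.range (emb : (Fin r → ℤ) → _)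
  · obtain ⟨m, rfl⟩ := hn
    obtain ⟨m', rfl⟩ := eq_emb_of_emb_le h
    rw [extPart_emb] at he ⊢
    have := SetLike.GradedSMul.smul_mem (A := polyPart k r) (B := ℳ)
      (monomial_mem_polyPart (k := k) (expo (emb m) (emb m'))) he
    rwa [vadd_eq_add, add_comm, monDeg_expo (emb_le.1 h)] at this
  · rw [extPart_infinitary ℳ hn, Submodule.mem_bot] at he
    rw [he, map_zero]
    exact zero_mem _

/-- The representation of `(ℤ ∪ {-∞})^r` that corresponds to the graded `S`-module `E`: the spaces
`E_n`, with multiplication by `x^{n' - n}` as the map `E_n → E_{n'}` for `n ≤ n'`. -/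
def repOf : (Fin r → WithBot ℤ) ⥤ ModuleCat.{u} k where
  obj n := ModuleCat.of k (extPart ℳ n)
  map {n n'} h := ModuleCat.ofHom <|
    (mulMonomial k E (expo n n')).restrict (mulMonomial_mem ℳ (leOfHom h))
  map_id n := by
    refine ModuleCat.hom_ext (LinearMap.ext fun e => Subtype.ext ?_)
    change mulMonomial k E (expo n n) e.1 = e.1
    rw [expo_self]
    exact one_smul (MvPolynomial (Fin r) k) e.1
  map_comp {n n' n''} h h' := by
    refine ModuleCat.hom_ext (LinearMap.ext fun e => Subtype.ext ?_)
    obtain ⟨e, he⟩ := e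
    change mulMonomial k E (expo n n'') e =
      mulMonomial k E (expo n' n'') (mulMonomial k E (expo n n') e)
    by_cases hn : n ∈ Set.range (emb : (Fin r → ℤ) → _)
    · obtain ⟨m, rfl⟩ := hn
      obtain ⟨m', rfl⟩ := eq_emb_of_emb_le (leOfHom h)
      obtain ⟨m'', rfl⟩ := eq_emb_of_emb_le (leOfHom h')
      simp only [mulMonomial, LinearMap.restrictScalars_apply, LinearMap.lsmul_apply, smul_smul,
        MvPolynomial.monomial_mul, mul_one,
        expo_add (emb_le.1 (leOfHom h)) (emb_le.1 (leOfHom h'))]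
    · rw [extPart_infinitary ℳ hn, Submodule.mem_bot] at he
      simp only [he, map_zero]

/-- The lcm-lattice `𝓛_E` of the graded module `E`. -/
def latticeOf : Set (Fin r → WithBot ℤ) := lcmLattice (initialSet (repOf ℳ))

/-- `zip E`: the restriction of the representation that corresponds to `E` to `𝓛_E`. -/
def zip : latticeOf ℳ ⥤ ModuleCat.{u} k :=
  (Subtype.mono_coe (· ∈ latticeOf ℳ)).functor ⋙ repOf ℳ

/-- `unzip F`, for a representation `F` of `𝓛_E`: the representation `n ↦ F (A_E n)` of `ℤ^r`, where
`A_E n` is the anchor element of `n` in `𝓛_E`. -/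
def unzip (F : latticeOf ℳ ⥤ ModuleCat.{u} k) : (Fin r → ℤ) ⥤ ModuleCat.{u} k :=
  (anchor_mono (initialSet (repOf ℳ))).functor ⋙ F

/-- `unzip` on morphisms. -/
def unzipMap {F G : latticeOf ℳ ⥤ ModuleCat.{u} k} (φ : F ⟶ G) : unzip ℳ F ⟶ unzip ℳ G :=
  Functor.whiskerLeft _ φ

/-- The natural map from `unzip (zip E)` to the representation of `ℤ^r` that corresponds to `E`,
given by `E_{A n} → E_n`. -/
def unzipZip : unzip ℳ (zip ℳ) ⟶ emb_mono.functor ⋙ repOf ℳ where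
  app n := (repOf ℳ).map (homOfLE (anchor_le _ n))
  naturality n n' h := by
    have hA := anchor_mono (initialSet (repOf ℳ)) (leOfHom h)
    exact ((repOf ℳ).map_comp (homOfLE hA) (homOfLE (anchor_le _ n'))).symm.trans
      ((repOf ℳ).map_comp (homOfLE (anchor_le _ n)) (homOfLE (emb_mono (leOfHom h))))

/-- The graded module of the representation that corresponds to `E` is identified with `E` by
`⨁ n, E_n → E`. -/
def realize : GradedOf (emb_mono.functor ⋙ repOf ℳ) →ₗ[MvPolynomial (Fin r) k] E :=
  let f : GradedOf (emb_mono.functor ⋙ repOf ℳ) →ₗ[k] E :=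
    GradedOf.desc fun n => (extPart ℳ (emb n)).subtype
  { toFun := f
    map_add' := map_add f
    map_smul' := linear_of_monomial f fun w x => by
      rw [GradedOf.monomial_smul]
      change (f ∘ₗ GradedOf.shift _ w) x = (mulMonomial k E w ∘ₗ f) x
      congr 1
      refine GradedOf.hom_ext fun n v => ?_
      have hw : expo (emb n) (emb (n + monDeg w)) = w := by
        ext i
        change ((n i + (w i : ℤ)) - n i).toNat = w i
        omega
      rw [LinearMap.comp_apply, LinearMap.comp_apply, GradedOf.shift_incl]
      refine (GradedOf.desc_incl _ _ _).trans (Eq.trans ?_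
        (congrArg (mulMonomial k E w) (GradedOf.desc_incl _ n v)).symm)
      change mulMonomial k E (expo (emb n) (emb (n + monDeg w))) v.1 = mulMonomial k E w v.1
      rw [hw] }

/-- The homomorphism of graded `S`-modules `unzip F → E` that is induced by a morphism
`ε : F ⟶ zip E`: the composite of `unzip ε` with the identification `unzip (zip E) ≅ E`. -/
def unzipAug {F : latticeOf ℳ ⥤ ModuleCat.{u} k} (ε : F ⟶ zip ℳ) :
    GradedOf (unzip ℳ F) →ₗ[MvPolynomial (Fin r) k] E :=
  realize ℳ ∘ₗ GradedOf.map (unzipZip ℳ) ∘ₗ GradedOf.map (unzipMap ℳ ε)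

end Graded

/-! ### Minimal graded free resolutions -/

section Minimal

variable {k : Type u} [Field k] {r : ℕ}

/-- The `S`-module `M` with the homogeneous parts `𝒢 n` is isomorphic, as a graded `S`-module, to
`⨁ j, S(-a j)`, where `S(-a)` is `S` with `S(-a)_n = S_{n - a}`. -/
def IsGradedFree {M : Type u} [AddCommGroup M] [Module k M] [Module (MvPolynomial (Fin r) k) M]
    (𝒢 : (Fin r → ℤ) → Submodule k M) {J : Type} (a : J → Fin r → ℤ) : Prop :=
  ∃ Φ : M ≃ₗ[MvPolynomial (Fin r) k] (J →₀ MvPolynomial (Fin r) k),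
    ∀ (n : Fin r → ℤ) (x : M), x ∈ 𝒢 n ↔ ∀ j, Φ x j ∈ polyPart k r (n - a j)

/-- `⋯ → M 1 → M 0 → E → 0`, with differentials `d` and augmentation `ε`, is a minimal
`ℤ^r`-graded free resolution, of finite length, of the graded `S`-module `E`: it is exact, its maps
are homogeneous of degree zero, every `M i` is a finite direct sum of shifted modules `S(-a)`, and
`d (M (i + 1)) ⊆ (x_1, …, x_r) M i`. -/
structure IsMinimalGradedFreeResolution
    {E : Type u} [AddCommGroup E] [Module k E] [Module (MvPolynomial (Fin r) k) E]
    (ℳ : (Fin r → ℤ) → Submodule k E)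
    {M : ℕ → Type u} [∀ i, AddCommGroup (M i)] [∀ i, Module k (M i)]
    [∀ i, Module (MvPolynomial (Fin r) k) (M i)]
    (𝒢 : ∀ i, (Fin r → ℤ) → Submodule k (M i))
    (d : ∀ i, M (i + 1) →ₗ[MvPolynomial (Fin r) k] M i)
    (ε : M 0 →ₗ[MvPolynomial (Fin r) k] E) : Prop where
  surjective : Function.Surjective ε
  exact_zero : Function.Exact (d 0) ε
  exact_succ : ∀ i, Function.Exact (d (i + 1)) (d i)
  degree_aug : ∀ n, ∀ x ∈ 𝒢 0 n, ε x ∈ ℳ n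
  degree_diff : ∀ i n, ∀ x ∈ 𝒢 (i + 1) n, d i x ∈ 𝒢 i n
  free : ∀ i, ∃ (b : ℕ) (a : Fin b → Fin r → ℤ), IsGradedFree (𝒢 i) a
  minimal : ∀ i, LinearMap.range (d i) ≤
    Ideal.span (Set.range (MvPolynomial.X : Fin r → MvPolynomial (Fin r) k)) •
      (⊤ : Submodule (MvPolynomial (Fin r) k) (M i))
  bounded : ∃ s, ∀ i, s < i → Subsingleton (M i)

end Minimal

end LcmResolution

end

namespace LcmResolution

noncomputable section

/-! ### Free representations and minimal covers -/

section Covers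

variable {k : Type u} [Field k] {P : Type} [PartialOrder P]

/-! A finitely generated graded module is governed by finitely many degrees. Choose finitely many
homogeneous generators and relations. For `m ≤ n` the map E_m → E_n is bijective as soon as every
generator and relation of degree `≤ n` already has degree `≤ m` (`exists_bounds`). So E_n is zero
once a coordinate of `n` drops below some `lo`, and a coordinate beyond some `hi` no longer matters.
Rounding coordinates down to {-∞} ∪ [lo, hi] therefore changes E only by isomorphisms, and it
preserves the condition that defines I_E(n) (`isIsoInterval_gridFloor`). Hence all initial elements
lie in a finite grid, the lcm-lattice is finite, and every I_E(n) is nonempty.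

The central fact is that E_{A(n)} → E_n is an isomorphism (`isIso_map_anchor`), so that unzip(zip E)
≅ E. Unzipping merely evaluates a representation at anchors, so it preserves exactness. Since l ≤
A(n) is equivalent to l ≤ n, it turns F^l into S(-l) for l in ℤ^r. Infinitary places contribute
nothing: zip E is zero at such a place and everywhere below it, and all syzygies and all F_i inherit
this (`subsingleton_of_le`).

Minimality comes from counting generators. F_i has at each place x exactly the number of generators
that the syzygy K covered by it needs there, so the induced surjection from F_x/F_{<x} to K_x/K_{<x}
is bijective and the kernel lies in the lower part (`ker_le_lowerPart`). The lower part is spanned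
by images from strictly smaller places; after unzipping these are multiples of nontrivial monomials
(`incl_mem_of_mem_lowerPart`).

Finite length follows too: a generator of the next syzygy at x requires a generator of F_i strictly
below x, so each step uses up an element of the finite lattice. Existence of the resolution is
Nakayama's lemma over a finite poset (`cover_surjective`), iterated. -/

theorem app_map_apply {V W : P ⥤ ModuleCat.{u} k} (φ : V ⟶ W) {x y : P} (h : x ⟶ y)
    (v : V.obj x) : (φ.app y).hom ((V.map h).hom v) = (W.map h).hom ((φ.app x).hom v) :=
  congrArg (fun g => g.hom v) (φ.naturality h)

theorem map_map_apply (V : P ⥤ ModuleCat.{u} k) {x y z : P} (h : x ⟶ y) (h' : y ⟶ z)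
    (h'' : x ⟶ z) (v : V.obj x) : (V.map h').hom ((V.map h).hom v) = (V.map h'').hom v := by
  rw [Subsingleton.elim h'' (h ≫ h'), V.map_comp]
  rfl

theorem map_self_apply (V : P ⥤ ModuleCat.{u} k) {x : P} (h : x ⟶ x) (v : V.obj x) :
    (V.map h).hom v = v := by
  rw [Subsingleton.elim h (𝟙 x), V.map_id]
  rfl

theorem iso_app_inv_hom {V W : P ⥤ ModuleCat.{u} k} (e : V ≅ W) (x : P) (v : V.obj x) :
    (e.inv.app x).hom ((e.hom.app x).hom v) = v := by
  simp

theorem iso_app_hom_inv {V W : P ⥤ ModuleCat.{u} k} (e : V ≅ W) (x : P) (v : W.obj x) :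
    (e.hom.app x).hom ((e.inv.app x).hom v) = v :=
  iso_app_inv_hom e.symm x v

/-- The generator of index `j` of a free representation, in a place `y ≥ x j`. -/
def freeRepGen (k : Type u) [Field k] {J : Type} {x : J → P} {j : J} {y : P} (h : x j ≤ y) :
    (freeRepOn k x).obj y :=
  (⟨Finsupp.single j 1, Finsupp.single_mem_supported k 1 h⟩ : Finsupp.supported k k {j | x j ≤ y})

theorem map_freeRepGen {J : Type} {x : J → P} {j : J} {y z : P} (h : x j ≤ y) (g : y ⟶ z) :
    ((freeRepOn k x).map g).hom (freeRepGen k h) = freeRepGen k (h.trans (leOfHom g)) :=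
  rfl

/-- The basis of generators of a free representation in the place `y`. -/
def freeRepEquiv (k : Type u) [Field k] {J : Type} (x : J → P) (y : P) :
    (freeRepOn k x).obj y ≃ₗ[k] ({j | x j ≤ y} →₀ k) :=
  Finsupp.supportedEquivFinsupp (R := k) (M := k) {j | x j ≤ y}

theorem freeRepEquiv_symm_single {J : Type} (x : J → P) (y : P) (j : {j | x j ≤ y}) :
    (freeRepEquiv k x y).symm (Finsupp.single j 1) = freeRepGen k j.2 :=
  Subtype.ext (Finsupp.supportedEquivFinsupp_symm_single _ j 1)

theorem freeRepOn_hom_ext {J : Type} {x : J → P} {y : P} {N : Type*} [AddCommGroup N] [Module k N]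
    {f g : (freeRepOn k x).obj y →ₗ[k] N}
    (h : ∀ (j : J) (hj : x j ≤ y), f (freeRepGen k hj) = g (freeRepGen k hj)) : f = g := by
  have key : f ∘ₗ (freeRepEquiv k x y).symm.toLinearMap =
      g ∘ₗ (freeRepEquiv k x y).symm.toLinearMap := by
    refine Finsupp.lhom_ext' fun j => LinearMap.ext_ring ?_
    simp only [LinearMap.comp_apply, LinearEquiv.coe_coe, Finsupp.lsingle_apply,
      freeRepEquiv_symm_single]
    exact h j j.2
  refine LinearMap.ext fun v => ?_
  have := congrArg (fun l => l (freeRepEquiv k x y v)) key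
  simpa using this

theorem freeRepOn_eq_top {J : Type} {x : J → P} {y : P}
    (N : Submodule k ((freeRepOn k x).obj y))
    (h : ∀ (j : J) (hj : x j ≤ y), freeRepGen k hj ∈ N) : N = ⊤ := by
  have : N.mkQ = 0 := freeRepOn_hom_ext fun j hj => by
    simpa using h j hj
  rw [← N.ker_mkQ, this, LinearMap.ker_zero]

/-- The image in the place `y` of an element in the place `x`; zero unless `x ≤ y`. -/
def spread (V : P ⥤ ModuleCat.{u} k) {x : P} (v : V.obj x) (y : P) : V.obj y :=
  open Classical in if h : x ≤ y then (V.map (homOfLE h)).hom v else 0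

theorem spread_of_le (V : P ⥤ ModuleCat.{u} k) {x y : P} (v : V.obj x) (h : x ≤ y) :
    spread V v y = (V.map (homOfLE h)).hom v :=
  dif_pos h

/-- The morphism out of a free representation with given values on the generators. -/
def freeRepDesc {V : P ⥤ ModuleCat.{u} k} {J : Type} (x : J → P) (v : ∀ j, V.obj (x j)) :
    freeRepOn k x ⟶ V where
  app y := ModuleCat.ofHom
    (Finsupp.linearCombination k (fun j => spread V (v j) y) ∘ₗ Submodule.subtype _)
  naturality y z h := by
    refine ModuleCat.hom_ext (freeRepOn_hom_ext fun j hj => ?_)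
    change Finsupp.linearCombination k (fun j => spread V (v j) z) (Finsupp.single j 1) =
      (V.map h).hom (Finsupp.linearCombination k (fun j => spread V (v j) y) (Finsupp.single j 1))
    simp only [Finsupp.linearCombination_single, one_smul]
    rw [spread_of_le V _ hj, spread_of_le V _ (hj.trans (leOfHom h)), map_map_apply]

theorem freeRepDesc_gen {V : P ⥤ ModuleCat.{u} k} {J : Type} {x : J → P}
    (v : ∀ j, V.obj (x j)) {j : J} {y : P} (h : x j ≤ y) :
    ((freeRepDesc x v).app y).hom (freeRepGen k h) = (V.map (homOfLE h)).hom (v j) := by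
  change Finsupp.linearCombination k (fun j => spread V (v j) y) (Finsupp.single j 1) = _
  rw [Finsupp.linearCombination_single, one_smul, spread_of_le]

theorem map_mem_lowerPart (V : P ⥤ ModuleCat.{u} k) {x y : P} (h : y < x) (g : y ⟶ x)
    (v : V.obj y) : (V.map g).hom v ∈ lowerPart V x :=
  le_iSup₂_of_le (f := fun (y : P) (h : y < x) => LinearMap.range (V.map (homOfLE h.le)).hom)
    y h le_rfl ⟨v, rfl⟩

theorem lowerPart_le (V : P ⥤ ModuleCat.{u} k) {x : P} {N : Submodule k (V.obj x)}
    (h : ∀ (y : P) (hy : y < x) (v : V.obj y), (V.map (homOfLE hy.le)).hom v ∈ N) :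
    lowerPart V x ≤ N := by
  refine iSup₂_le fun y hy => ?_
  rintro _ ⟨v, rfl⟩
  exact h y hy v

theorem lowerPart_le_comap {V W : P ⥤ ModuleCat.{u} k} (φ : V ⟶ W) (x : P) :
    lowerPart V x ≤ (lowerPart W x).comap (φ.app x).hom :=
  lowerPart_le V fun y hy v => by
    rw [Submodule.mem_comap, app_map_apply]
    exact map_mem_lowerPart W hy _ _

theorem freeDim_congr {V W : P ⥤ ModuleCat.{u} k} (e : V ≅ W) (x : P) :
    freeDim V x = freeDim W x := by
  let l : V.obj x ≃ₗ[k] W.obj x :=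
    LinearEquiv.ofLinearMap (e.hom.app x).hom (e.inv.app x).hom
      (LinearMap.ext fun v => iso_app_hom_inv e x v) (LinearMap.ext fun v => iso_app_inv_hom e x v)
  refine LinearEquiv.finrank_eq (Submodule.Quotient.equiv _ _ l (le_antisymm ?_ fun w hw => ?_))
  · exact Submodule.map_le_iff_le_comap.2 (lowerPart_le_comap e.hom x)
  · exact ⟨(e.inv.app x).hom w, lowerPart_le_comap e.inv x hw, iso_app_hom_inv e x w⟩

theorem freeDim_eq_zero {V : P ⥤ ModuleCat.{u} k} {x : P} [Subsingleton (V.obj x)] :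
    freeDim V x = 0 :=
  Module.finrank_zero_of_subsingleton

/-- The free dimension of the free representation `⨁ x, (F^x)^{f x}` in `x` is at most `f x`. -/
theorem finite_quotient_lowerPart {F : P ⥤ ModuleCat.{u} k} {f : P → ℕ}
    (e : F ≅ freeRepOn k (fun j : (Σ x : P, Fin (f x)) => j.1)) (x : P) :
    Module.Finite k (F.obj x ⧸ lowerPart F x) ∧
      Module.finrank k (F.obj x ⧸ lowerPart F x) ≤ f x := by
  let b : Fin (f x) → F.obj x ⧸ lowerPart F x := fun i =>
    (lowerPart F x).mkQ ((e.inv.app x).hom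
      (freeRepGen k (x := fun j : (Σ x : P, Fin (f x)) => j.1) (j := ⟨x, i⟩) le_rfl))
  have hb : Submodule.span k (Set.range b) = ⊤ := by
    have h1 : (Submodule.span k (Set.range b)).comap
        ((lowerPart F x).mkQ ∘ₗ (e.inv.app x).hom) = ⊤ := by
      refine freeRepOn_eq_top _ ?_
      rintro ⟨y, i⟩ (hy : y ≤ x)
      rw [Submodule.mem_comap, LinearMap.comp_apply]
      -- A generator that starts strictly below `x` is the image of itself in its own place, hence
      -- dies in the quotient; only the `f x` generators in `x` remain.
      rcases hy.eq_or_lt with rfl | hlt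
      · exact Submodule.subset_span ⟨i, rfl⟩
      · have : (e.inv.app x).hom (freeRepGen k (x := fun j : (Σ x : P, Fin (f x)) => j.1)
            (j := ⟨y, i⟩) hy) ∈ lowerPart F x := by
          have h2 := map_freeRepGen (k := k) (x := fun j : (Σ x : P, Fin (f x)) => j.1)
            (j := ⟨y, i⟩) le_rfl (homOfLE hy)
          rw [← h2, app_map_apply e.inv]
          exact map_mem_lowerPart F hlt _ _
        rw [Submodule.mkQ_apply, (Submodule.Quotient.mk_eq_zero _).2 this]
        exact zero_mem _
    refine eq_top_iff.2 fun q _ => ?_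
    obtain ⟨v, rfl⟩ := (lowerPart F x).mkQ_surjective q
    have h3 : (e.hom.app x).hom v ∈ (Submodule.span k (Set.range b)).comap
        ((lowerPart F x).mkQ ∘ₗ (e.inv.app x).hom) := h1 ▸ Submodule.mem_top
    rwa [Submodule.mem_comap, LinearMap.comp_apply, iso_app_inv_hom] at h3
  refine ⟨⟨⟨(Set.finite_range b).toFinset, by simpa using hb⟩⟩, ?_⟩
  have := finrank_range_le_card (R := k) b
  rwa [Set.finrank, hb, finrank_top, Fintype.card_fin] at this

/-- If `F ≅ ⨁ x, (F^x)^{f x}` covers `K`, where `f x` is the free dimension of `K` in `x`, then the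
kernel consists of non-generators. -/
theorem ker_le_lowerPart {F K : P ⥤ ModuleCat.{u} k} (e : F ≅ freeRep k (freeDim K)) (φ : F ⟶ K)
    (hφ : ∀ x, Function.Surjective (φ.app x).hom) (x : P) :
    LinearMap.ker (φ.app x).hom ≤ lowerPart F x := by
  obtain ⟨hfin, hle⟩ := finite_quotient_lowerPart e x
  let q : (F.obj x ⧸ lowerPart F x) →ₗ[k] (K.obj x ⧸ lowerPart K x) :=
    Submodule.mapQ _ _ (φ.app x).hom (lowerPart_le_comap φ x)
  have hq : Function.Surjective q := fun w => by
    obtain ⟨w, rfl⟩ := (lowerPart K x).mkQ_surjective w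
    obtain ⟨v, rfl⟩ := hφ x w
    exact ⟨(lowerPart F x).mkQ v, rfl⟩
  -- `freeDim` is a `finrank`, so it would be 0 for an infinite-dimensional quotient; finiteness is
  -- inherited from `F`. The dimensions are then squeezed: at most `freeDim K x` by the number of
  -- generators, at least that by surjectivity of `q`.
  have : Module.Finite k (K.obj x ⧸ lowerPart K x) := Module.Finite.of_surjective q hq
  have heq : Module.finrank k (F.obj x ⧸ lowerPart F x) =
      Module.finrank k (K.obj x ⧸ lowerPart K x) :=
    le_antisymm hle (LinearMap.finrank_le_finrank_of_surjective hq)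
  have hinj : Function.Injective q := (LinearMap.injective_iff_surjective_of_finrank_eq_finrank
    heq).2 hq
  intro v hv
  rw [LinearMap.mem_ker] at hv
  refine (Submodule.Quotient.mk_eq_zero _).1 (hinj ?_)
  rw [map_zero]
  change (lowerPart K x).mkQ ((φ.app x).hom v) = 0
  rw [hv, map_zero]

theorem subsingleton_freeRepOn {J : Type} {x : J → P} {y : P} (h : ∀ j, ¬ x j ≤ y) :
    Subsingleton ((freeRepOn k x).obj y) := by
  have h0 : (⊥ : Submodule k ((freeRepOn k x).obj y)) = ⊤ :=
    freeRepOn_eq_top _ fun j hj => absurd hj (h j)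
  exact (Submodule.subsingleton_iff k).1 (subsingleton_of_bot_eq_top h0)

theorem subsingleton_of_iso {V W : P ⥤ ModuleCat.{u} k} (e : V ≅ W) (x : P)
    [Subsingleton (W.obj x)] : Subsingleton (V.obj x) :=
  Function.Injective.subsingleton (f := (e.hom.app x).hom)
    (Function.LeftInverse.injective (g := (e.inv.app x).hom) (iso_app_inv_hom e x))

theorem subsingleton_of_iso_freeRep {F : P ⥤ ModuleCat.{u} k} {f : P → ℕ} (e : F ≅ freeRep k f)
    {y : P} (h : ∀ x ≤ y, f x = 0) : Subsingleton (F.obj y) := by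
  have : Subsingleton ((freeRep k f).obj y) := subsingleton_freeRepOn fun j hj => by
    have hj2 := j.2
    rw [h _ hj] at hj2
    exact hj2.elim0
  exact subsingleton_of_iso e y

/-- The inclusion of the kernel. -/
def kerIncl {V W : P ⥤ ModuleCat.{u} k} (φ : V ⟶ W) : kerRep φ ⟶ V where
  app x := ModuleCat.ofHom (LinearMap.ker (φ.app x).hom).subtype
  naturality _ _ _ := rfl

theorem kerIncl_injective {V W : P ⥤ ModuleCat.{u} k} (φ : V ⟶ W) (x : P) :
    Function.Injective ((kerIncl φ).app x).hom :=
  Subtype.val_injective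

theorem app_kerIncl {V W : P ⥤ ModuleCat.{u} k} (φ : V ⟶ W) (x : P) (v : (kerRep φ).obj x) :
    (φ.app x).hom (((kerIncl φ).app x).hom v) = 0 :=
  v.2

theorem exists_kerIncl_eq {V W : P ⥤ ModuleCat.{u} k} (φ : V ⟶ W) {x : P} {v : V.obj x}
    (h : (φ.app x).hom v = 0) : ∃ u, ((kerIncl φ).app x).hom u = v :=
  ⟨⟨v, h⟩, rfl⟩

/-- The factorization through the kernel. -/
def kerLift {U V W : P ⥤ ModuleCat.{u} k} (φ : V ⟶ W) (ψ : U ⟶ V)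
    (h : ∀ x u, (φ.app x).hom ((ψ.app x).hom u) = 0) : U ⟶ kerRep φ where
  app x := ModuleCat.ofHom ((ψ.app x).hom.codRestrict (LinearMap.ker (φ.app x).hom) (h x))
  naturality x y g := by
    refine ModuleCat.hom_ext (LinearMap.ext fun u => Subtype.ext ?_)
    exact app_map_apply ψ g u

theorem kerLift_eq_zero_iff {U V W : P ⥤ ModuleCat.{u} k} (φ : V ⟶ W) (ψ : U ⟶ V)
    (h : ∀ x u, (φ.app x).hom ((ψ.app x).hom u) = 0) (x : P) (u : U.obj x) :
    ((kerLift φ ψ h).app x).hom u = 0 ↔ (ψ.app x).hom u = 0 :=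
  (map_eq_zero_iff _ (kerIncl_injective φ x)).symm

/-- Composition with an injective morphism does not change the kernel. -/
def kerRepCompIso {U V W : P ⥤ ModuleCat.{u} k} (φ : U ⟶ V) (ψ : V ⟶ W)
    (h : ∀ x, Function.Injective (ψ.app x).hom) : kerRep (φ ≫ ψ) ≅ kerRep φ where
  hom := kerLift φ (kerIncl (φ ≫ ψ)) fun x u => h x (by
    rw [map_zero]
    exact app_kerIncl (φ ≫ ψ) x u)
  inv := kerLift (φ ≫ ψ) (kerIncl φ) fun x u => by
    change (ψ.app x).hom ((φ.app x).hom _) = 0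
    rw [app_kerIncl, map_zero]
  hom_inv_id := rfl
  inv_hom_id := rfl

end Covers

/-! ### Free resolutions over a poset -/

section Resolutions

variable {k : Type u} [Field k] {P : Type} [PartialOrder P]

/-- Lifts of a basis of `V_x / V_{<x}`. -/
def coverGen (V : P ⥤ ModuleCat.{u} k) [∀ x, Module.Finite k (V.obj x)]
    (j : Σ x : P, Fin (freeDim V x)) : V.obj j.1 :=
  ((lowerPart V j.1).mkQ_surjective
    (Module.finBasis k (V.obj j.1 ⧸ lowerPart V j.1) j.2)).choose

theorem mkQ_coverGen (V : P ⥤ ModuleCat.{u} k) [∀ x, Module.Finite k (V.obj x)]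
    (j : Σ x : P, Fin (freeDim V x)) : (lowerPart V j.1).mkQ (coverGen V j) =
      Module.finBasis k (V.obj j.1 ⧸ lowerPart V j.1) j.2 :=
  ((lowerPart V j.1).mkQ_surjective
    (Module.finBasis k (V.obj j.1 ⧸ lowerPart V j.1) j.2)).choose_spec

/-- The minimal free cover of a pointwise finite-dimensional representation. -/
def cover (V : P ⥤ ModuleCat.{u} k) [∀ x, Module.Finite k (V.obj x)] :
    freeRep k (freeDim V) ⟶ V :=
  freeRepDesc _ (coverGen V)

/-- Nakayama's lemma by induction over the places: the image contains everything coming from smaller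
places, and the lifted bases generate the rest. Finiteness of `P` makes the induction well-founded.
-/
theorem cover_surjective [Finite P] (V : P ⥤ ModuleCat.{u} k) [∀ x, Module.Finite k (V.obj x)]
    (x : P) : Function.Surjective ((cover V).app x).hom := by
  rw [← LinearMap.range_eq_top]
  induction x using WellFoundedLT.induction with
  | _ x ih =>
  set R := LinearMap.range ((cover V).app x).hom with hR
  have hlow : lowerPart V x ≤ R := lowerPart_le V fun y hy v => by
    obtain ⟨u, rfl⟩ := LinearMap.range_eq_top.1 (ih y hy) v
    exact ⟨_, app_map_apply (cover V) (homOfLE hy.le) u⟩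
  have hbas : Submodule.map (lowerPart V x).mkQ R = ⊤ := by
    rw [eq_top_iff, ← (Module.finBasis k (V.obj x ⧸ lowerPart V x)).span_eq, Submodule.span_le]
    rintro _ ⟨i, rfl⟩
    refine ⟨coverGen V ⟨x, i⟩, ⟨freeRepGen k (x := fun j : (Σ x : P, Fin (freeDim V x)) => j.1)
      (j := ⟨x, i⟩) le_rfl, ?_⟩, mkQ_coverGen V ⟨x, i⟩⟩
    exact (freeRepDesc_gen (coverGen V) _).trans (map_self_apply V _ _)
  refine eq_top_iff.2 fun v _ => ?_
  obtain ⟨u, hu, huv⟩ : (lowerPart V x).mkQ v ∈ Submodule.map (lowerPart V x).mkQ R :=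
    hbas ▸ Submodule.mem_top
  have : v - u ∈ lowerPart V x := (Submodule.Quotient.mk_eq_zero _).1 (by
    rw [← Submodule.mkQ_apply, map_sub, huv, sub_self])
  simpa using add_mem (hlow this) hu

theorem finite_freeRepOn {J : Type} [Finite J] (x : J → P) (y : P) :
    Module.Finite k ((freeRepOn k x).obj y) :=
  Module.Finite.equiv (freeRepEquiv k x y).symm

/-- The iterated syzygies with respect to minimal free covers. -/
def iterSyzygy [Finite P] (V : {V : P ⥤ ModuleCat.{u} k // ∀ x, Module.Finite k (V.obj x)}) :
    ℕ → {V : P ⥤ ModuleCat.{u} k // ∀ x, Module.Finite k (V.obj x)}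
  | 0 => V
  | i + 1 =>
    have := (iterSyzygy V i).2
    ⟨kerRep (cover (iterSyzygy V i).1), fun x =>
      have : Module.Finite k ((freeRep k (freeDim (iterSyzygy V i).1)).obj x) :=
        finite_freeRepOn _ x
      Module.Finite.of_injective _
        (kerIncl_injective (cover (iterSyzygy V i).1) x)⟩

instance [Finite P] (V : {V : P ⥤ ModuleCat.{u} k // ∀ x, Module.Finite k (V.obj x)}) (i : ℕ)
    (x : P) : Module.Finite k ((iterSyzygy V i).1.obj x) :=
  (iterSyzygy V i).2 x

theorem exists_isFreeResolution [Finite P] (V : P ⥤ ModuleCat.{u} k)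
    (hV : ∀ x, Module.Finite k (V.obj x)) :
    ∃ (F : ℕ → (P ⥤ ModuleCat.{u} k)) (d : ∀ i, F (i + 1) ⟶ F i) (ε : F 0 ⟶ V),
      IsFreeResolution d ε := by
  let K := iterSyzygy ⟨V, hV⟩
  let ι : ∀ i, (K (i + 1)).1 ⟶ freeRep k (freeDim (K i).1) := fun i => kerIncl (cover (K i).1)
  let d : ∀ i, freeRep k (freeDim (K (i + 1)).1) ⟶ freeRep k (freeDim (K i).1) :=
    fun i => cover (K (i + 1)).1 ≫ ι i
  have hd : ∀ i x u, ((d i).app x).hom u =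
      ((ι i).app x).hom (((cover (K (i + 1)).1).app x).hom u) := fun _ _ _ => rfl
  have hex : ∀ i x, Function.Exact ((d i).app x).hom ((cover (K i).1).app x).hom := by
    intro i x v
    constructor
    · intro hv
      obtain ⟨w, rfl⟩ := exists_kerIncl_eq _ hv
      obtain ⟨u, rfl⟩ := cover_surjective (K (i + 1)).1 x w
      exact ⟨u, rfl⟩
    · rintro ⟨u, rfl⟩
      exact app_kerIncl (cover (K i).1) x _
  refine ⟨fun i => freeRep k (freeDim (K i).1), d, cover (K 0).1, cover_surjective V, hex 0,
    fun i x v => ?_, fun i => ?_⟩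
  · rw [← hex (i + 1) x v, hd]
    exact map_eq_zero_iff _ (kerIncl_injective (cover (K i).1) x)
  · match i with
    | 0 => exact ⟨Iso.refl _⟩
    | 1 => exact ⟨Iso.refl _⟩
    | i + 2 =>
      -- The resolution has the kernel of the composite `d i` as its syzygy, the iteration has the
      -- kernel of the cover alone. These are isomorphic, not equal, so it is their free dimensions
      -- that are compared.
      refine ⟨eqToIso (congrArg (freeRep k) (funext fun x => ?_))⟩
      exact (freeDim_congr (kerRepCompIso (cover (K (i + 1)).1) (ι i)
        (kerIncl_injective (cover (K i).1))) x).symm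

variable {V : P ⥤ ModuleCat.{u} k} {F : ℕ → (P ⥤ ModuleCat.{u} k)}
  {d : ∀ i, F (i + 1) ⟶ F i} {ε : F 0 ⟶ V}

namespace IsFreeResolution

/-- Exactness makes each differential a surjection onto the next kernel. This puts all steps of the
resolution, including the first, into the form that `ker_le_lowerPart` needs. -/
theorem exists_cover (h : IsFreeResolution d ε) (i : ℕ) : ∃ c : F i ⟶ syzygy d ε i,
    (∀ x, Function.Surjective (c.app x).hom) ∧
      ∀ x, Function.Exact ((d i).app x).hom (c.app x).hom := by
  match i with
  | 0 => exact ⟨ε, h.surjective, h.exact_zero⟩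
  | 1 =>
    refine ⟨kerLift ε (d 0) fun x u => (h.exact_zero x).apply_apply_eq_zero u,
      fun x w => ?_, fun x v => ?_⟩
    · obtain ⟨u, hu⟩ := (h.exact_zero x _).1 (app_kerIncl ε x w)
      exact ⟨u, kerIncl_injective ε x hu⟩
    · exact (kerLift_eq_zero_iff ε (d 0) _ x v).trans (h.exact_succ 0 x v)
  | i + 2 =>
    refine ⟨kerLift (d i) (d (i + 1)) fun x u => (h.exact_succ i x).apply_apply_eq_zero u,
      fun x w => ?_, fun x v => ?_⟩
    · obtain ⟨u, hu⟩ := (h.exact_succ i x _).1 (app_kerIncl (d i) x w)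
      exact ⟨u, kerIncl_injective (d i) x hu⟩
    · exact (kerLift_eq_zero_iff (d i) (d (i + 1)) _ x v).trans (h.exact_succ (i + 1) x v)

theorem range_le_lowerPart (h : IsFreeResolution d ε) (i : ℕ) (x : P) :
    LinearMap.range ((d i).app x).hom ≤ lowerPart (F i) x := by
  obtain ⟨c, hc, hex⟩ := h.exists_cover i
  obtain ⟨e⟩ := h.free i
  rw [← LinearMap.exact_iff.1 (hex x)]
  exact ker_le_lowerPart e c hc x

theorem exists_syzygy_incl (h : IsFreeResolution d ε) (i : ℕ) :
    ∃ ι : syzygy d ε (i + 1) ⟶ F i, ∀ x, Function.Injective (ι.app x).hom ∧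
      LinearMap.range (ι.app x).hom ≤ lowerPart (F i) x := by
  match i with
  | 0 =>
    refine ⟨kerIncl ε, fun x => ⟨kerIncl_injective ε x, ?_⟩⟩
    rintro _ ⟨u, rfl⟩
    exact h.range_le_lowerPart 0 x ((h.exact_zero x _).1 (app_kerIncl ε x u))
  | i + 1 =>
    refine ⟨kerIncl (d i), fun x => ⟨kerIncl_injective (d i) x, ?_⟩⟩
    rintro _ ⟨u, rfl⟩
    exact h.range_le_lowerPart (i + 1) x ((h.exact_succ i x _).1 (app_kerIncl (d i) x u))

/-- Vanishing on a down-set propagates: a zero syzygy has no generators there, so neither has the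
free representation that covers it, and the next syzygy embeds into that one. -/
theorem subsingleton_of_le (h : IsFreeResolution d ε) {x : P}
    (hx : ∀ y ≤ x, Subsingleton (V.obj y)) (i : ℕ) :
    ∀ y ≤ x, Subsingleton ((syzygy d ε i).obj y) ∧ Subsingleton ((F i).obj y) := by
  induction i with
  | zero =>
    intro y hy
    obtain ⟨e⟩ := h.free 0
    refine ⟨hx y hy, subsingleton_of_iso_freeRep e fun z hz => ?_⟩
    have := hx z (hz.trans hy)
    exact freeDim_eq_zero (V := V)
  | succ i ih =>
    have hs : ∀ y ≤ x, Subsingleton ((syzygy d ε (i + 1)).obj y) := fun y hy => by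
      obtain ⟨ι, hι⟩ := h.exists_syzygy_incl i
      have := (ih y hy).2
      exact (hι y).1.subsingleton
    intro y hy
    obtain ⟨e⟩ := h.free (i + 1)
    refine ⟨hs y hy, subsingleton_of_iso_freeRep e fun z hz => ?_⟩
    have := hs z (hz.trans hy)
    exact freeDim_eq_zero

theorem multiplicity_eq_zero (h : IsFreeResolution d ε) {x : P}
    (hx : ∀ y ≤ x, Subsingleton (V.obj y)) (i : ℕ) : multiplicity d ε i x = 0 := by
  have := (h.subsingleton_of_le hx i x le_rfl).1
  exact freeDim_eq_zero

/-- The next syzygy lies in the lower part of `F i`, so it can be nonzero in `x` only if `F i` has a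
generator in some `z < x`. The count of elements strictly below the place therefore grows with every
step. -/
theorem le_ncard_of_multiplicity_ne_zero [Finite P] (h : IsFreeResolution d ε) (i : ℕ) :
    ∀ x, multiplicity d ε i x ≠ 0 → i ≤ (Set.Iio x).ncard := by
  induction i with
  | zero => exact fun _ _ => Nat.zero_le _
  | succ i ih =>
    intro x hx
    obtain ⟨ι, hι⟩ := h.exists_syzygy_incl i
    obtain ⟨e⟩ := h.free i
    by_contra hlt
    refine hx ?_
    have hF : ∀ y < x, Subsingleton ((F i).obj y) := fun y hy =>
      subsingleton_of_iso_freeRep e fun z hz => by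
        by_contra hne
        have hzx := hz.trans_lt hy
        have : (Set.Iio z).ncard < (Set.Iio x).ncard :=
          Set.ncard_lt_ncard ⟨Set.Iio_subset_Iio hzx.le, fun hs => lt_irrefl z (hs hzx)⟩
        have := ih z hne
        omega
    have hlow : lowerPart (F i) x ≤ ⊥ := lowerPart_le _ fun y hy v => by
      have := hF y hy
      rw [Subsingleton.elim v 0, map_zero]
      exact zero_mem _
    have : Subsingleton ((syzygy d ε (i + 1)).obj x) := ⟨fun a b => (hι x).1 <| by
      rw [(Submodule.mem_bot k).1 (hlow ((hι x).2 ⟨a, rfl⟩)),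
        (Submodule.mem_bot k).1 (hlow ((hι x).2 ⟨b, rfl⟩))]⟩
    exact freeDim_eq_zero

theorem subsingleton_of_card_lt [Finite P] (h : IsFreeResolution d ε) {i : ℕ} (hi : Nat.card P < i)
    (x : P) : Subsingleton ((F i).obj x) := by
  obtain ⟨e⟩ := h.free i
  refine subsingleton_of_iso_freeRep e fun y _ => ?_
  by_contra hne
  have h1 := h.le_ncard_of_multiplicity_ne_zero i y hne
  have h2 := Set.ncard_le_card (Set.Iio y)
  omega

end IsFreeResolution

end Resolutions

/-! ### Graded modules and representations of `ℤ^r` -/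

section GradedModules

variable {k : Type u} [Field k] {r : ℕ}

namespace GradedOf

variable {U V W : (Fin r → ℤ) ⥤ ModuleCat.{u} k}

/-- The component of degree `n`. -/
def proj (V : (Fin r → ℤ) ⥤ ModuleCat.{u} k) (n : Fin r → ℤ) : GradedOf V →ₗ[k] V.obj n :=
  DirectSum.component k (Fin r → ℤ) (fun n => V.obj n) n

theorem proj_incl_self (n : Fin r → ℤ) (v : V.obj n) : proj V n (incl V n v) = v :=
  DirectSum.component.lof_self (M := fun n => V.obj n) k n v

theorem proj_incl_of_ne {m n : Fin r → ℤ} (h : m ≠ n) (v : V.obj m) :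
    proj V n (incl V m v) = 0 :=
  DFinsupp.single_eq_of_ne h.symm

theorem ext_proj {x y : GradedOf V} (h : ∀ n, proj V n x = proj V n y) : x = y :=
  DFinsupp.ext h

theorem exists_finset_proj (x : GradedOf V) :
    ∃ D : Finset (Fin r → ℤ), ∀ n ∉ D, proj V n x = 0 := by
  classical
  exact ⟨DFinsupp.support x, fun n hn => DFinsupp.notMem_support_iff.1 hn⟩

/-- Formulated for additive submonoids so that it serves ranges of `S`-linear maps as well as
multiples of an ideal. -/
theorem mem_of_proj_mem {N : AddSubmonoid (GradedOf V)} {x : GradedOf V}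
    (h : ∀ n, incl V n (proj V n x) ∈ N) : x ∈ N := by
  classical
  have hx : ∑ n ∈ DFinsupp.support x, incl V n (proj V n x) = x :=
    DirectSum.sum_support_of x
  rw [← hx]
  exact sum_mem fun n _ => h n

theorem map_incl (φ : V ⟶ W) (n : Fin r → ℤ) (v : V.obj n) :
    map φ (incl V n v) = incl W n ((φ.app n).hom v) :=
  desc_incl (fun n => incl W n ∘ₗ (φ.app n).hom) n v

theorem proj_map (φ : V ⟶ W) (n : Fin r → ℤ) (x : GradedOf V) :
    proj W n (map φ x) = (φ.app n).hom (proj V n x) := by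
  have : proj W n ∘ₗ (map φ).restrictScalars k = (φ.app n).hom ∘ₗ proj V n := by
    refine hom_ext fun m v => ?_
    simp only [LinearMap.comp_apply, LinearMap.restrictScalars_apply, map_incl]
    by_cases h : m = n
    · subst h
      rw [proj_incl_self, proj_incl_self]
    · rw [proj_incl_of_ne h, proj_incl_of_ne h, map_zero]
  exact congrArg (fun l => l x) this

theorem map_injective (φ : V ⟶ W) (h : ∀ n, Function.Injective (φ.app n).hom) :
    Function.Injective (map φ) := fun x y hxy => ext_proj fun n => h n <| by
  rw [← proj_map, ← proj_map, hxy]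

theorem map_surjective (φ : V ⟶ W) (h : ∀ n, Function.Surjective (φ.app n).hom) :
    Function.Surjective (map φ) := fun y => by
  change y ∈ (LinearMap.range (map φ)).toAddSubmonoid
  refine mem_of_proj_mem fun n => ?_
  obtain ⟨u, hu⟩ := h n (proj W n y)
  exact ⟨incl V n u, by rw [map_incl, hu]⟩

theorem surjective_of_map_surjective (φ : V ⟶ W) (h : Function.Surjective (map φ))
    (n : Fin r → ℤ) : Function.Surjective (φ.app n).hom := fun w => by
  obtain ⟨x, hx⟩ := h (incl W n w)
  exact ⟨proj V n x, by rw [← proj_map, hx, proj_incl_self]⟩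

theorem map_exact (φ : U ⟶ V) (ψ : V ⟶ W)
    (h : ∀ n, Function.Exact (φ.app n).hom (ψ.app n).hom) :
    Function.Exact (map φ) (map ψ) := fun y => by
  constructor
  · intro hy
    change y ∈ (LinearMap.range (map φ)).toAddSubmonoid
    refine mem_of_proj_mem fun n => ?_
    obtain ⟨u, hu⟩ := (h n (proj V n y)).1 (by rw [← proj_map, hy, map_zero])
    exact ⟨incl U n u, by rw [map_incl, hu]⟩
  · rintro ⟨x, rfl⟩
    refine ext_proj fun n => ?_
    rw [proj_map, proj_map, (h n).apply_apply_eq_zero, map_zero]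

theorem map_mem_part (φ : V ⟶ W) {n : Fin r → ℤ} {x : GradedOf V} (hx : x ∈ part V n) :
    map φ x ∈ part W n := by
  obtain ⟨v, rfl⟩ := hx
  exact ⟨(φ.app n).hom v, (map_incl φ n v).symm⟩

theorem monomial_smul_incl (w : Fin r →₀ ℕ) {m n : Fin r → ℤ} (e : m + monDeg w = n) (h : m ≤ n)
    (v : V.obj m) :
    MvPolynomial.monomial w (1 : k) • incl V m v = incl V n ((V.map (homOfLE h)).hom v) := by
  rw [monomial_smul, shift_incl]
  exact incl_map_congr V e _ _ v

/-- The isomorphism of graded modules that corresponds to an isomorphism of representations. -/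
def mapIso (e : V ≅ W) : GradedOf V ≃ₗ[MvPolynomial (Fin r) k] GradedOf W :=
  LinearEquiv.ofLinearMap (map e.hom) (map e.inv)
    (LinearMap.ext fun x => ext_proj fun n => by
      simp only [LinearMap.comp_apply, proj_map, iso_app_hom_inv, LinearMap.id_apply])
    (LinearMap.ext fun x => ext_proj fun n => by
      simp only [LinearMap.comp_apply, proj_map, iso_app_inv_hom, LinearMap.id_apply])

theorem mapIso_mem_part (e : V ≅ W) {n : Fin r → ℤ} {x : GradedOf V} :
    mapIso e x ∈ part W n ↔ x ∈ part V n := by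
  refine ⟨fun h => ?_, map_mem_part e.hom⟩
  rw [← (mapIso e).symm_apply_apply x]
  exact map_mem_part e.inv h

end GradedOf

open GradedOf

theorem weight_eq_monDeg (w : Fin r →₀ ℕ) :
    Finsupp.weight (fun i : Fin r => (Pi.single i 1 : Fin r → ℤ)) w = monDeg w := by
  funext j
  rw [Finsupp.weight_apply, Finsupp.sum_fintype _ _ (by simp)]
  simp [monDeg, Finset.sum_apply, Pi.single_apply]

theorem smul_mem_part {V : (Fin r → ℤ) ⥤ ModuleCat.{u} k} {m n : Fin r → ℤ}
    {p : MvPolynomial (Fin r) k} (hp : p ∈ polyPart k r (n - m)) (v : V.obj m) :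
    p • incl V m v ∈ part V n := by
  rw [← p.support_sum_monomial_coeff, Finset.sum_smul]
  refine sum_mem fun w hw => ?_
  have hw' := ((MvPolynomial.mem_weightedHomogeneousSubmodule _ _ _ _).1 hp)
    (MvPolynomial.mem_support_iff.1 hw)
  rw [weight_eq_monDeg] at hw'
  have hm : MvPolynomial.monomial w (p.coeff w) =
      p.coeff w • MvPolynomial.monomial w (1 : k) := by
    simp [MvPolynomial.smul_monomial]
  have hn : m + monDeg w = n := by rw [hw']; abel
  rw [hm, smul_assoc, monomial_smul_incl w hn (hn ▸ le_add_monDeg m w)]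
  exact Submodule.smul_mem _ _ ⟨_, rfl⟩

theorem expo_add_monDeg (n : Fin r → ℤ) (w : Fin r →₀ ℕ) :
    expo (emb n) (emb (n + monDeg w)) = w := by
  ext i
  change ((n i + (w i : ℤ)) - n i).toNat = w i
  omega

/-! ### Free representations of ℤ^r as direct sums of shifted polynomial rings -/

section Free

variable {J : Type} (a : J → Fin r → ℤ)

/-- The map from `⨁ j, S(-a j)` to the graded module of the free representation. -/
def ofPolys (k : Type u) [Field k] : (J →₀ MvPolynomial (Fin r) k) →ₗ[MvPolynomial (Fin r) k]
    GradedOf (freeRepOn k a) :=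
  Finsupp.linearCombination (MvPolynomial (Fin r) k)
    fun j => incl (freeRepOn k a) (a j) (freeRepGen k le_rfl)

/-- The map from the graded module of the free representation to `⨁ j, S(-a j)`. -/
def toPolys (k : Type u) [Field k] :
    GradedOf (freeRepOn k a) →ₗ[k] (J →₀ MvPolynomial (Fin r) k) :=
  desc fun n => Finsupp.linearCombination k (fun j => Finsupp.single j
    (MvPolynomial.monomial (expo (emb (a j)) (emb n)) (1 : k))) ∘ₗ Submodule.subtype _

theorem toPolys_gen {n : Fin r → ℤ} {j : J} (h : a j ≤ n) :
    toPolys a k (incl _ n (freeRepGen k h)) =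
      Finsupp.single j (MvPolynomial.monomial (expo (emb (a j)) (emb n)) (1 : k)) := by
  refine (desc_incl _ n _).trans ?_
  change Finsupp.linearCombination k _ (Finsupp.single j 1) = _
  rw [Finsupp.linearCombination_single, one_smul]

theorem ofPolys_single {n : Fin r → ℤ} {j : J} (h : a j ≤ n) (w : Fin r →₀ ℕ)
    (e : a j + monDeg w = n) :
    ofPolys a k (Finsupp.single j (MvPolynomial.monomial w (1 : k))) =
      incl _ n (freeRepGen k h) := by
  rw [ofPolys, Finsupp.linearCombination_single, monomial_smul_incl w e h, map_freeRepGen]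

theorem ofPolys_toPolys (x : GradedOf (freeRepOn k a)) : ofPolys a k (toPolys a k x) = x := by
  have : (ofPolys a k).restrictScalars k ∘ₗ toPolys a k = LinearMap.id := by
    refine hom_ext fun n => LinearMap.congr_fun
      (f := ((ofPolys a k).restrictScalars k ∘ₗ toPolys a k) ∘ₗ incl _ n)
      (g := LinearMap.id ∘ₗ incl _ n) (freeRepOn_hom_ext fun j hj => ?_)
    simp only [LinearMap.comp_apply, LinearMap.restrictScalars_apply, toPolys_gen,
      LinearMap.id_apply]
    exact ofPolys_single a hj _ (monDeg_expo hj)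
  exact congrArg (fun l => l x) this

theorem toPolys_ofPolys (y : J →₀ MvPolynomial (Fin r) k) : toPolys a k (ofPolys a k y) = y := by
  have : toPolys a k ∘ₗ (ofPolys a k).restrictScalars k = LinearMap.id := by
    refine Finsupp.lhom_ext' fun j => MvPolynomial.linearMap_ext fun w => LinearMap.ext_ring ?_
    simp only [LinearMap.comp_apply, LinearMap.restrictScalars_apply, Finsupp.lsingle_apply,
      LinearMap.id_apply]
    rw [ofPolys_single a (le_add_monDeg (a j) w) w rfl, toPolys_gen, expo_add_monDeg]
  exact congrArg (fun l => l y) this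

/-- The graded module of the free representation is `⨁ j, S(-a j)`. -/
def polysEquiv (k : Type u) [Field k] : GradedOf (freeRepOn k a) ≃ₗ[MvPolynomial (Fin r) k]
    (J →₀ MvPolynomial (Fin r) k) :=
  (LinearEquiv.ofBijective (ofPolys a k)
    ⟨Function.LeftInverse.injective (g := toPolys a k) (toPolys_ofPolys a),
      Function.RightInverse.surjective (g := toPolys a k) (ofPolys_toPolys a)⟩).symm

theorem polysEquiv_apply (x : GradedOf (freeRepOn k a)) : polysEquiv a k x = toPolys a k x := by
  rw [polysEquiv, LinearEquiv.symm_apply_eq]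
  exact (ofPolys_toPolys a x).symm

theorem toPolys_mem_polyPart (n : Fin r → ℤ) (v : (freeRepOn k a).obj n) (j : J) :
    toPolys a k (incl _ n v) j ∈ polyPart k r (n - a j) := by
  have h : (polyPart k r (n - a j)).comap (Finsupp.lapply j ∘ₗ toPolys a k ∘ₗ incl _ n) = ⊤ := by
    refine freeRepOn_eq_top _ fun i hi => ?_
    rw [Submodule.mem_comap, LinearMap.comp_apply, LinearMap.comp_apply, toPolys_gen,
      Finsupp.lapply_apply]
    by_cases hij : i = j
    · subst hij
      rw [Finsupp.single_eq_same]
      have h2 := monomial_mem_polyPart (k := k) (expo (emb (a i)) (emb n))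
      rwa [eq_sub_of_add_eq' (monDeg_expo hi)] at h2
    · rw [Finsupp.single_eq_of_ne' hij]
      exact zero_mem _
  have hv : v ∈ (polyPart k r (n - a j)).comap (Finsupp.lapply j ∘ₗ toPolys a k ∘ₗ incl _ n) :=
    h ▸ Submodule.mem_top
  exact hv

theorem isGradedFree_of_iso {V : (Fin r → ℤ) ⥤ ModuleCat.{u} k} (e : V ≅ freeRepOn k a) :
    IsGradedFree (part V) a := by
  refine ⟨(mapIso e).trans (polysEquiv a k), fun n x => ?_⟩
  rw [← mapIso_mem_part e, LinearEquiv.trans_apply]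
  generalize mapIso e x = y
  constructor
  · rintro ⟨v, rfl⟩ j
    rw [polysEquiv_apply]
    exact toPolys_mem_polyPart a n v j
  · intro h
    rw [← (polysEquiv a k).symm_apply_apply y]
    generalize polysEquiv a k y = z at h
    change ofPolys a k z ∈ _
    rw [ofPolys, Finsupp.linearCombination_apply]
    exact sum_mem fun j _ => smul_mem_part (h j) _

theorem IsGradedFree.reindex {M : Type u} [AddCommGroup M] [Module k M]
    [Module (MvPolynomial (Fin r) k) M] {𝒢 : (Fin r → ℤ) → Submodule k M} {J' : Type} {a}
    (h : IsGradedFree 𝒢 a) (e : J' ≃ J) : IsGradedFree 𝒢 (a ∘ e) := by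
  obtain ⟨Φ, hΦ⟩ := h
  refine ⟨Φ.trans (Finsupp.domLCongr e.symm), fun n x => ?_⟩
  rw [hΦ, ← e.forall_congr_right]
  simp [Finsupp.domLCongr_apply, Finsupp.domCongr_apply, Finsupp.equivMapDomain_apply]

end Free

/-- The representation that corresponds to a finitely generated graded module has finitely many
generators. -/
theorem exists_generators (V : (Fin r → ℤ) ⥤ ModuleCat.{u} k)
    [Module.Finite (MvPolynomial (Fin r) k) (GradedOf V)] :
    ∃ (J : Type) (_ : Finite J) (a : J → Fin r → ℤ) (v : ∀ j, V.obj (a j)),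
      ∀ n, Function.Surjective ((freeRepDesc a v).app n).hom := by
  obtain ⟨s, t, ht⟩ := Module.Finite.exists_fin (R := MvPolynomial (Fin r) k) (M := GradedOf V)
  choose D hD using fun i => exists_finset_proj (t i)
  -- The homogeneous components of a finite generating set generate as well; `D i` contains all
  -- degrees in which the generator `t i` has a nonzero component.
  let a : (Σ i : Fin s, D i) → Fin r → ℤ := fun j => j.2.1
  let v : ∀ j, V.obj (a j) := fun j => proj V j.2.1 (t j.1)
  refine ⟨Σ i : Fin s, D i, inferInstance, a, v, surjective_of_map_surjective _ ?_⟩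
  rw [← LinearMap.range_eq_top, eq_top_iff, ← ht, Submodule.span_le]
  rintro _ ⟨i, rfl⟩
  change t i ∈ (LinearMap.range (GradedOf.map (freeRepDesc a v))).toAddSubmonoid
  refine mem_of_proj_mem fun n => ?_
  by_cases hn : n ∈ D i
  · refine ⟨incl _ n (freeRepGen k (x := a) (j := ⟨i, n, hn⟩) le_rfl), ?_⟩
    rw [map_incl, freeRepDesc_gen, map_self_apply]
  · rw [hD i n hn, map_zero]
    exact zero_mem _

theorem finite_gradedOf_freeRepOn {J : Type} [Finite J] (a : J → Fin r → ℤ) :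
    Module.Finite (MvPolynomial (Fin r) k) (GradedOf (freeRepOn k a)) :=
  Module.Finite.equiv (polysEquiv a k).symm

/-- `S` is Noetherian, so the module of relations among finitely many generators is again finitely
generated. -/
theorem exists_presentation (V : (Fin r → ℤ) ⥤ ModuleCat.{u} k)
    [Module.Finite (MvPolynomial (Fin r) k) (GradedOf V)] :
    ∃ (J : Type) (_ : Finite J) (a : J → Fin r → ℤ) (v : ∀ j, V.obj (a j))
      (I : Type) (_ : Finite I) (b : I → Fin r → ℤ) (w : ∀ i, (kerRep (freeRepDesc a v)).obj (b i)),
      (∀ n, Function.Surjective ((freeRepDesc a v).app n).hom) ∧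
        ∀ n, Function.Surjective ((freeRepDesc b w).app n).hom := by
  obtain ⟨J, hJ, a, v, hv⟩ := exists_generators V
  have := finite_gradedOf_freeRepOn (k := k) a
  have : Module.Finite (MvPolynomial (Fin r) k) (GradedOf (kerRep (freeRepDesc a v))) :=
    Module.Finite.of_injective (GradedOf.map (kerIncl (freeRepDesc a v)))
      (map_injective _ (kerIncl_injective _))
  obtain ⟨I, hI, b, w, hw⟩ := exists_generators (kerRep (freeRepDesc a v))
  exact ⟨J, hJ, a, v, I, hI, b, w, hv, hw⟩

/-- A representation that corresponds to a finitely generated graded module is zero below some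
bound `lo`, and beyond some bound `hi` its maps are isomorphisms. -/
theorem exists_bounds (V : (Fin r → ℤ) ⥤ ModuleCat.{u} k)
    [Module.Finite (MvPolynomial (Fin r) k) (GradedOf V)] :
    ∃ lo hi : ℤ, lo ≤ hi ∧ (∀ n i, n i < lo → Subsingleton (V.obj n)) ∧
      ∀ (m n : Fin r → ℤ) (h : m ≤ n), (∀ i, m i = n i ∨ hi ≤ m i) →
        Function.Bijective (V.map (homOfLE h)).hom := by
  obtain ⟨J, hJ, a, v, I, hI, b, w, hv, hw⟩ := exists_presentation V
  obtain ⟨lo, hlo⟩ := (Set.finite_range fun p : J × Fin r => a p.1 p.2).bddBelow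
  obtain ⟨hi₁, h₁⟩ := (Set.finite_range fun p : J × Fin r => a p.1 p.2).bddAbove
  obtain ⟨hi₂, h₂⟩ := (Set.finite_range fun p : I × Fin r => b p.1 p.2).bddAbove
  -- Including `lo` in the maximum guarantees `lo ≤ hi` even when there are no generators or
  -- relations.
  refine ⟨lo, max lo (max hi₁ hi₂), le_max_left _ _, fun n i hn => ?_, fun m n h hmn => ?_⟩
  · have : Subsingleton ((freeRepOn k a).obj n) := subsingleton_freeRepOn fun j hj =>
      absurd (hj i) (not_le.2 (hn.trans_le (hlo ⟨(j, i), rfl⟩)))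
    exact (hv n).subsingleton
  -- Where `m` and `n` differ, `m` is already beyond all generator and relation degrees, so none of
  -- them first appears between `m` and `n`.
  · have ha : ∀ j, a j ≤ n → a j ≤ m := fun j hj i => by
      have h3 := h₁ ⟨(j, i), rfl⟩
      have h4 := hj i
      rcases hmn i with h5 | h5
      · rwa [h5]
      · exact h3.trans ((le_max_left _ _).trans ((le_max_right _ _).trans h5))
    have hb : ∀ j, b j ≤ n → b j ≤ m := fun j hj i => by
      have h3 := h₂ ⟨(j, i), rfl⟩
      have h4 := hj i
      rcases hmn i with h5 | h5
      · rwa [h5]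
      · exact h3.trans ((le_max_right _ _).trans ((le_max_right _ _).trans h5))
    -- Used twice: for `V` with its generators, and for the kernel with the relations.
    have surj : ∀ {K : Type} {c : K → Fin r → ℤ} {W : (Fin r → ℤ) ⥤ ModuleCat.{u} k}
        (φ : freeRepOn k c ⟶ W), (∀ j, c j ≤ n → c j ≤ m) →
        Function.Surjective (φ.app n).hom → Function.Surjective (W.map (homOfLE h)).hom := by
      intro K c W φ hc hφ x
      obtain ⟨u, rfl⟩ := hφ x
      have htop := freeRepOn_eq_top
        (LinearMap.range ((freeRepOn k c).map (homOfLE h)).hom)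
        fun j hj => ⟨freeRepGen k (hc j hj), rfl⟩
      obtain ⟨u', rfl⟩ := LinearMap.range_eq_top.1 htop u
      exact ⟨(φ.app m).hom u', (app_map_apply φ _ u').symm⟩
    refine ⟨?_, surj _ ha (hv n)⟩
    -- A lift `u` of `x` becomes a relation in degree `n`. That relation already comes from degree
    -- `m`, where it must equal `u`, because the maps of a free representation are injective.
    rw [injective_iff_map_eq_zero]
    intro x hx
    obtain ⟨u, rfl⟩ := hv m x
    rw [← app_map_apply] at hx
    obtain ⟨y, hy⟩ := exists_kerIncl_eq _ hx
    obtain ⟨z, rfl⟩ := surj _ hb (hw n) y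
    rw [app_map_apply] at hy
    have hinj : Function.Injective ((freeRepOn k a).map (homOfLE h)).hom :=
      Submodule.inclusion_injective (Finsupp.supported_mono fun _ hj => le_trans hj h)
    rw [← hinj hy, app_kerIncl]

theorem finite_obj (V : (Fin r → ℤ) ⥤ ModuleCat.{u} k)
    [Module.Finite (MvPolynomial (Fin r) k) (GradedOf V)] (n : Fin r → ℤ) :
    Module.Finite k (V.obj n) := by
  obtain ⟨J, hJ, a, v, hv⟩ := exists_generators V
  have := finite_freeRepOn (k := k) a n
  exact Module.Finite.of_surjective _ (hv n)

end GradedModules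

/-! ### The lcm-lattice of a finitely generated graded module -/

section Floor

variable {r : ℕ}

/-- The greatest element `≤ t` of `{-∞} ∪ [lo, hi]`. -/
def floorCoord (lo hi : ℤ) (t : WithBot ℤ) : WithBot ℤ :=
  if t < lo then ⊥ else min t hi

theorem floorCoord_mono (lo hi : ℤ) : Monotone (floorCoord lo hi) := fun s t h => by
  unfold floorCoord
  split_ifs with h1 h2
  · exact le_rfl
  · exact bot_le
  · exact absurd (h.trans_lt ‹_›) h1
  · exact min_le_min_right _ h

theorem floorCoord_le (lo hi : ℤ) (t : WithBot ℤ) : floorCoord lo hi t ≤ t := by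
  unfold floorCoord
  split_ifs
  · exact bot_le
  · exact min_le_left _ _

theorem floorCoord_floorCoord {lo hi : ℤ} (h : lo ≤ hi) (t : WithBot ℤ) :
    floorCoord lo hi (floorCoord lo hi t) = floorCoord lo hi t := by
  have h' : (lo : WithBot ℤ) ≤ hi := WithBot.coe_le_coe.2 h
  unfold floorCoord
  split_ifs with h1 h2 h3
  · rfl
  · exact absurd (WithBot.bot_lt_coe lo) h2
  · exact absurd h3 (not_lt.2 (le_min (not_lt.1 h1) h'))
  · rw [min_assoc, min_self]

/-- The three alternatives match the three reasons for a map to be an isomorphism: zero spaces, no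
change in this coordinate, or a change beyond `hi` only. -/
theorem eq_of_floorCoord_eq {lo hi : ℤ} (hlo : lo ≤ hi) {s t : WithBot ℤ}
    (e : floorCoord lo hi s = floorCoord lo hi t) : t < lo ∨ s = t ∨ hi ≤ s := by
  have h' : (lo : WithBot ℤ) ≤ hi := WithBot.coe_le_coe.2 hlo
  by_contra! hne
  obtain ⟨h1, h2, h3⟩ := hne
  unfold floorCoord at e
  rw [if_neg (not_lt.2 h1)] at e
  split_ifs at e with h4
  · exact absurd (WithBot.bot_lt_coe lo) (not_lt.2 (e ▸ le_min h1 h'))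
  · rw [min_eq_left h3.le] at e
    rcases min_choice t (hi : WithBot ℤ) with h5 | h5
    · exact h2 (e.trans h5)
    · exact h3.ne (e.trans h5)

theorem finite_floorCoord_eq (lo hi : ℤ) : {t | floorCoord lo hi t = t}.Finite := by
  refine (((Set.finite_Icc lo hi).image ((↑) : ℤ → WithBot ℤ)).insert ⊥).subset fun t ht => ?_
  induction t using WithBot.recBotCoe with
  | bot => exact Or.inl rfl
  | coe z =>
    refine Or.inr ⟨z, ?_, rfl⟩
    change floorCoord lo hi z = z at ht
    unfold floorCoord at ht
    split_ifs at ht with h1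
    · exact absurd ht.symm WithBot.coe_ne_bot
    · exact ⟨WithBot.coe_le_coe.1 (not_lt.1 h1), WithBot.coe_le_coe.1 (min_eq_left_iff.1 ht)⟩

/-- The greatest element `≤ x` of `({-∞} ∪ [lo, hi])^r`. -/
def gridFloor (lo hi : ℤ) (x : Fin r → WithBot ℤ) : Fin r → WithBot ℤ :=
  fun i => floorCoord lo hi (x i)

theorem gridFloor_mono (lo hi : ℤ) :
    Monotone (gridFloor lo hi : (Fin r → WithBot ℤ) → Fin r → WithBot ℤ) :=
  fun _ _ h i => floorCoord_mono lo hi (h i)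

theorem gridFloor_le (lo hi : ℤ) (x : Fin r → WithBot ℤ) : gridFloor lo hi x ≤ x :=
  fun i => floorCoord_le lo hi (x i)

theorem gridFloor_gridFloor {lo hi : ℤ} (h : lo ≤ hi) (x : Fin r → WithBot ℤ) :
    gridFloor lo hi (gridFloor lo hi x) = gridFloor lo hi x :=
  funext fun i => floorCoord_floorCoord h (x i)

theorem gridFloor_sup (lo hi : ℤ) (x y : Fin r → WithBot ℤ) :
    gridFloor lo hi (x ⊔ y) = gridFloor lo hi x ⊔ gridFloor lo hi y :=
  funext fun i => (floorCoord_mono lo hi).map_sup (x i) (y i)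

/-- The grid `({-∞} ∪ [lo, hi])^r`. -/
def grid (r : ℕ) (lo hi : ℤ) : Set (Fin r → WithBot ℤ) := {x | gridFloor lo hi x = x}

theorem finite_grid (lo hi : ℤ) : (grid r lo hi).Finite :=
  (Set.Finite.pi' fun _ => finite_floorCoord_eq lo hi).subset fun _ hx i => congrFun hx i

theorem supClosed_grid (lo hi : ℤ) : SupClosed (grid r lo hi) := fun x hx y hy =>
  (gridFloor_sup lo hi x y).trans (congrArg₂ _ hx hy)

theorem lcmLattice_subset_grid {lo hi : ℤ} {A : Set (Fin r → WithBot ℤ)} (h : A ⊆ grid r lo hi) :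
    lcmLattice A ⊆ grid r lo hi := by
  rintro x (hx | rfl)
  · exact supClosure_min h (supClosed_grid lo hi) hx.1
  · exact le_bot_iff.1 (gridFloor_le lo hi ⊥)

end Floor

/-! ### Bounded representations: finiteness of the lcm-lattice and the anchor isomorphism -/

section Initial

variable {k : Type u} [Field k] {r : ℕ}

/-- `V` is zero at infinitary elements and below `lo`, and its maps beyond `hi` are
isomorphisms. -/
structure IsBoundedBy (V : (Fin r → WithBot ℤ) ⥤ ModuleCat.{u} k) (lo hi : ℤ) : Prop where
  le : lo ≤ hi
  infinitary : ∀ x ∉ Set.range emb, Subsingleton (V.obj x)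
  below : ∀ n i, n i < lo → Subsingleton (V.obj (emb n))
  beyond : ∀ (m n : Fin r → ℤ) (h : m ≤ n), (∀ i, m i = n i ∨ hi ≤ m i) →
    IsIso (V.map (homOfLE (emb_mono h)))

theorem isIso_of_subsingleton {M N : ModuleCat.{u} k} (f : M ⟶ N) [Subsingleton M]
    [Subsingleton N] : IsIso f :=
  (ConcreteCategory.isIso_iff_bijective f).2
    ⟨Function.injective_of_subsingleton _, fun _ => ⟨0, Subsingleton.elim _ _⟩⟩

theorem map_homOfLE_comp (V : (Fin r → WithBot ℤ) ⥤ ModuleCat.{u} k) {x y z : Fin r → WithBot ℤ}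
    (h : x ≤ y) (h' : y ≤ z) :
    V.map (homOfLE h) ≫ V.map (homOfLE h') = V.map (homOfLE (h.trans h')) :=
  (V.map_comp _ _).symm

variable {V : (Fin r → WithBot ℤ) ⥤ ModuleCat.{u} k} {lo hi : ℤ}

theorem IsBoundedBy.subsingleton (hV : IsBoundedBy V lo hi) {x : Fin r → WithBot ℤ} {i : Fin r}
    (h : x i < lo) : Subsingleton (V.obj x) := by
  by_cases hx : x ∈ Set.range (emb : (Fin r → ℤ) → _)
  · obtain ⟨n, rfl⟩ := hx
    exact hV.below n i (WithBot.coe_lt_coe.1 h)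
  · exact hV.infinitary x hx

theorem IsBoundedBy.isIso_of_gridFloor_eq (hV : IsBoundedBy V lo hi) {x y : Fin r → WithBot ℤ}
    (h : x ≤ y) (e : gridFloor lo hi x = gridFloor lo hi y) : IsIso (V.map (homOfLE h)) := by
  have hc := fun i => eq_of_floorCoord_eq hV.le (congrFun e i)
  by_cases hy : ∃ i, y i < lo
  · obtain ⟨i, hi⟩ := hy
    have := hV.subsingleton hi
    have := hV.subsingleton ((h i).trans_lt hi)
    exact isIso_of_subsingleton _
  · push Not at hy
    by_cases hx : x ∈ Set.range (emb : (Fin r → ℤ) → _)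
    · obtain ⟨m, rfl⟩ := hx
      obtain ⟨n, rfl⟩ := eq_emb_of_emb_le h
      refine hV.beyond m n (emb_le.1 h) fun i => ?_
      rcases hc i with h1 | h1 | h1
      · exact absurd h1 (not_lt.2 (hy i))
      · exact Or.inl (WithBot.coe_injective h1)
      · exact Or.inr (WithBot.coe_le_coe.1 h1)
    -- If `y` were finite, every coordinate of `x` would be at least `lo`, so `x` would be finite
    -- too. Hence both are infinitary and both spaces are zero.
    · have hy' : y ∉ Set.range (emb : (Fin r → ℤ) → _) := by
        rintro ⟨n, rfl⟩
        have hb : ∀ i, (lo : WithBot ℤ) ≤ x i := fun i => by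
          rcases hc i with h1 | h1 | h1
          · exact absurd h1 (not_lt.2 (hy i))
          · rw [h1]
            exact hy i
          · exact (WithBot.coe_le_coe.2 hV.le).trans h1
        exact hx (eq_emb_of_emb_le (m := fun _ => lo) hb)
      have := hV.infinitary x hx
      have := hV.infinitary y hy'
      exact isIso_of_subsingleton _

/-- A place `z` between the rounded `x` and `n` is compared with `z ⊔ x`: both have the same
rounding, so the map between them is an isomorphism, and `z ⊔ x` lies in the original interval. The
remaining maps follow by two-out-of-three. -/
theorem IsBoundedBy.isIsoInterval_gridFloor (hV : IsBoundedBy V lo hi) {n x : Fin r → WithBot ℤ}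
    (hx : IsIsoInterval V n x) : IsIsoInterval V n (gridFloor lo hi x) := by
  have key : ∀ z, gridFloor lo hi x ≤ z → ∀ h' : z ≤ n, IsIso (V.map (homOfLE h')) := by
    intro z hz h'
    have h1 : IsIso (V.map (homOfLE (le_sup_left : z ≤ z ⊔ x))) := by
      refine hV.isIso_of_gridFloor_eq _ ?_
      rw [gridFloor_sup, left_eq_sup, ← gridFloor_gridFloor hV.le x]
      exact gridFloor_mono lo hi hz
    have h2 := (hx.2 (z ⊔ x) le_sup_right (sup_le h' hx.1)).2
    rw [← map_homOfLE_comp V le_sup_left (sup_le h' hx.1)]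
    infer_instance
  have hn := (gridFloor_le lo hi x).trans hx.1
  refine ⟨hn, fun z h h' => ⟨?_, key z h h'⟩⟩
  have h1 := key z h h'
  have h2 := key _ le_rfl hn
  rw [← map_homOfLE_comp V h h'] at h2
  exact IsIso.of_isIso_comp_right _ (V.map (homOfLE h'))

theorem IsBoundedBy.initialSet_subset_grid (hV : IsBoundedBy V lo hi) :
    initialSet V ⊆ grid r lo hi := fun x hx => by
  obtain ⟨n, hn⟩ := Set.mem_iUnion.1 hx
  exact le_antisymm (gridFloor_le lo hi x)
    (hn.2 (hV.isIsoInterval_gridFloor hn.1) (gridFloor_le lo hi x))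

theorem IsBoundedBy.finite_lcmLattice (hV : IsBoundedBy V lo hi) :
    Finite (lcmLattice (initialSet V)) :=
  (finite_grid lo hi).subset (lcmLattice_subset_grid hV.initialSet_subset_grid)

theorem isIsoInterval_self (n : Fin r → WithBot ℤ) : IsIsoInterval V n n := by
  refine ⟨le_rfl, fun z h h' => ?_⟩
  obtain rfl := le_antisymm h h'
  have : V.map (homOfLE h) = 𝟙 _ := V.map_id n
  exact ⟨this ▸ inferInstance, this ▸ inferInstance⟩

/-- The order on (ℤ ∪ {-∞})^r is not well-founded in general, so a minimal element is sought in the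
finite grid. It is minimal among all places, since any smaller candidate can be rounded down into
the grid. -/
theorem IsBoundedBy.exists_mem_initialAt (hV : IsBoundedBy V lo hi) (n : Fin r → ℤ) :
    ∃ x, x ∈ initialAt V n := by
  obtain ⟨x, hx⟩ := ((finite_grid lo hi).inter_of_left
    {x | IsIsoInterval V (emb n) x}).exists_minimal
    ⟨gridFloor lo hi (emb n), gridFloor_gridFloor hV.le _,
      hV.isIsoInterval_gridFloor (isIsoInterval_self _)⟩
  refine ⟨x, hx.1.2, fun y hy hyx => ?_⟩
  exact (hx.2 ⟨gridFloor_gridFloor hV.le y, hV.isIsoInterval_gridFloor hy⟩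
    ((gridFloor_le lo hi y).trans hyx)).trans (gridFloor_le lo hi y)

/-- Let `x` be an initial element for `n`. It suffices that `x ≤ A(n)`, for then A(n) lies in the
interval of isomorphisms. This holds if `x` is finite, since then `x` is in the lattice, and also if
A(n) is finite, since then the maximum of A(n) and `x` is in the lattice and `≤ n`. -/
theorem IsBoundedBy.isIso_map_anchor (hV : IsBoundedBy V lo hi) (n : Fin r → ℤ) :
    IsIso (V.map (homOfLE (anchor_le (initialSet V) n))) := by
  obtain ⟨x, hx⟩ := hV.exists_mem_initialAt n
  have hmem : x ∈ initialSet V := Set.mem_iUnion.2 ⟨n, hx⟩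
  have hx1 := hx.1
  have done : x ≤ anchor (initialSet V) n →
      IsIso (V.map (homOfLE (anchor_le (initialSet V) n))) :=
    fun h => (hx1.2 _ h (anchor_le _ n)).2
  by_cases hxr : x ∈ Set.range (emb : (Fin r → ℤ) → _)
  · exact done (le_anchor (l := ⟨x, Or.inl ⟨subset_supClosure hmem, hxr⟩⟩) hx1.1)
  · by_cases ha : (anchor (initialSet V) n : Fin r → WithBot ℤ) ∈ Set.range (emb : (Fin r → ℤ) → _)
    · refine done (le_sup_right.trans (le_anchor (l := ⟨anchor (initialSet V) n ⊔ x, Or.inl ⟨?_, ?_⟩⟩)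
        (sup_le (anchor_le _ n) hx1.1)))
      · rcases (anchor (initialSet V) n).2 with h | h
        · exact supClosed_supClosure h.1 (subset_supClosure hmem)
        · rw [Set.mem_singleton_iff.1 h, bot_sup_eq]
          exact subset_supClosure hmem
      · obtain ⟨m, hm⟩ := ha
        exact eq_emb_of_emb_le (m := m) (hm ▸ le_sup_left)
    -- With both infinitary, `x` and the anchor need not be comparable, but all spaces vanish: V_n ≅
    -- V_x = 0 and V_{A(n)} = 0.
    · have h1 := hV.infinitary _ ha
      have h2 := hV.infinitary _ hxr
      have h3 := (hx1.2 x le_rfl hx1.1).2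
      have h4 : Subsingleton (V.obj (emb n)) :=
        ((ConcreteCategory.isIso_iff_bijective _).1 h3).2.subsingleton
      exact isIso_of_subsingleton _

end Initial

/-! ### The graded module E and its representation -/

section Module

variable {k : Type u} [Field k] {r : ℕ} {E : Type u} [AddCommGroup E] [Module k E]
  [Module (MvPolynomial (Fin r) k) E] [IsScalarTower k (MvPolynomial (Fin r) k) E]
  (ℳ : (Fin r → ℤ) → Submodule k E) [SetLike.GradedSMul (polyPart k r) ℳ]

theorem realize_incl (n : Fin r → ℤ) (v : (repOf ℳ).obj (emb n)) :
    realize ℳ (GradedOf.incl (emb_mono.functor ⋙ repOf ℳ) n v) = v.1 :=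
  GradedOf.desc_incl (V := emb_mono.functor ⋙ repOf ℳ)
    (fun n => (extPart ℳ (emb n)).subtype) n v

theorem realize_bijective (hℳ : DirectSum.IsInternal ℳ) : Function.Bijective (realize ℳ) := by
  have h : DirectSum.IsInternal fun n => extPart ℳ (emb n) := by
    rwa [funext (extPart_emb ℳ)]
  have he : ⇑(realize ℳ) = DirectSum.coeAddMonoidHom fun n => extPart ℳ (emb n) := by
    have : (realize ℳ).restrictScalars k =
        DirectSum.coeLinearMap (fun n => extPart ℳ (emb n)) :=
      GradedOf.hom_ext fun n v => (realize_incl ℳ n v).trans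
        (DirectSum.coeLinearMap_lof (fun n => extPart ℳ (emb n)) n v).symm
    exact congrArg (fun l x => l x) this
  rw [he]
  exact h

theorem exists_isBoundedBy [Module.Finite (MvPolynomial (Fin r) k)
    (GradedOf (emb_mono.functor ⋙ repOf ℳ))] : ∃ lo hi, IsBoundedBy (repOf ℳ) lo hi := by
  obtain ⟨lo, hi, hle, h1, h2⟩ := exists_bounds (emb_mono.functor ⋙ repOf ℳ)
  refine ⟨lo, hi, hle, fun x hx => ?_, h1, fun m n h hmn =>
    (ConcreteCategory.isIso_iff_bijective _).2 (h2 m n h hmn)⟩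
  change Subsingleton (extPart ℳ x)
  rw [extPart_infinitary ℳ hx]
  infer_instance

end Module

/-! ### Unzipping -/

section Unzip

variable {k : Type u} [Field k]

theorem freeRepEquiv_gen {P J : Type} [PartialOrder P] {x : J → P} {j : J} {y : P} (h : x j ≤ y) :
    freeRepEquiv k x y (freeRepGen k h) = Finsupp.single ⟨j, h⟩ 1 := by
  rw [← freeRepEquiv_symm_single x y ⟨j, h⟩, LinearEquiv.apply_symm_apply]

/-- Free representations of two posets in places where the same generators are present. -/
def freeRepReindex (k : Type u) [Field k] {P Q I J : Type} [PartialOrder P] [PartialOrder Q]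
    (a : I → P) (b : J → Q) (e : I ≃ J) (x : P) (y : Q) (h : ∀ i, a i ≤ x ↔ b (e i) ≤ y) :
    (freeRepOn k a).obj x ≃ₗ[k] (freeRepOn k b).obj y :=
  (freeRepEquiv k a x).trans
    ((Finsupp.domLCongr (e.subtypeEquiv h)).trans (freeRepEquiv k b y).symm)

theorem freeRepReindex_gen {P Q I J : Type} [PartialOrder P] [PartialOrder Q]
    (a : I → P) (b : J → Q) (e : I ≃ J) (x : P) (y : Q) (h : ∀ i, a i ≤ x ↔ b (e i) ≤ y)
    {i : I} (hi : a i ≤ x) :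
    freeRepReindex k a b e x y h (freeRepGen k hi) = freeRepGen k ((h i).1 hi) := by
  rw [freeRepReindex, LinearEquiv.trans_apply, LinearEquiv.trans_apply, freeRepEquiv_gen,
    Finsupp.domLCongr_single]
  exact freeRepEquiv_symm_single b y _

variable {r : ℕ} {E : Type u} [AddCommGroup E] [Module k E]
  [Module (MvPolynomial (Fin r) k) E] [IsScalarTower k (MvPolynomial (Fin r) k) E]
  (ℳ : (Fin r → ℤ) → Submodule k E) [SetLike.GradedSMul (polyPart k r) ℳ]

/-- The anchor element of `n` in `𝓛_E`. -/
def anchorOf (n : Fin r → ℤ) : latticeOf ℳ := anchor (initialSet (repOf ℳ)) n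

theorem anchorOf_le (n : Fin r → ℤ) : (anchorOf ℳ n : Fin r → WithBot ℤ) ≤ emb n :=
  anchor_le _ n

/-- This equivalence is why unzipping preserves freeness: in the place A(n) exactly those generators
are present whose place is `≤ n`. -/
theorem le_anchorOf_iff {l : latticeOf ℳ} {n : Fin r → ℤ} :
    l ≤ anchorOf ℳ n ↔ (l : Fin r → WithBot ℤ) ≤ emb n :=
  ⟨fun h => le_trans h (anchorOf_le ℳ n), le_anchor⟩

theorem anchorOf_mono : Monotone (anchorOf ℳ) := anchor_mono _

/-- The inclusion of the part of degree `n`. -/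
def unzipIncl (F : latticeOf ℳ ⥤ ModuleCat.{u} k) (n : Fin r → ℤ) :
    F.obj (anchorOf ℳ n) →ₗ[k] GradedOf (unzip ℳ F) :=
  GradedOf.incl (unzip ℳ F) n

/-- The unzipping of a free representation with generators in the places `emb (a i)`. -/
def unzipFreeIso {I J : Type} (a : I → Fin r → ℤ) (b : J → latticeOf ℳ) (e : I ≃ J)
    (h : ∀ i, (b (e i) : Fin r → WithBot ℤ) = emb (a i)) :
    freeRepOn k a ≅ unzip ℳ (freeRepOn k b) :=
  NatIso.ofComponents
    (fun n => (freeRepReindex k a b e n (anchorOf ℳ n) fun i => by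
      rw [le_anchorOf_iff, h, emb_le]).toModuleIso)
    fun {m n} g => ModuleCat.hom_ext <| freeRepOn_hom_ext fun i hi => by
      change freeRepReindex k a b e n _ _ (((freeRepOn k a).map g).hom (freeRepGen k hi)) =
        ((freeRepOn k b).map (homOfLE (anchorOf_mono ℳ (leOfHom g)))).hom
          (freeRepReindex k a b e m _ _ (freeRepGen k hi))
      rw [map_freeRepGen, freeRepReindex_gen, freeRepReindex_gen, map_freeRepGen]

/-- The hypothesis `hf` is essential: on the unzipping of F^l with `l` infinitary, the variables of
the coordinates -∞ act bijectively, so it is not a free module. -/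
theorem isGradedFree_unzip {F : latticeOf ℳ ⥤ ModuleCat.{u} k} {f : latticeOf ℳ → ℕ}
    (e : F ≅ freeRep k f)
    (hf : ∀ l : latticeOf ℳ, (l : Fin r → WithBot ℤ) ∉ Set.range emb → f l = 0) :
    IsGradedFree (GradedOf.part (unzip ℳ F))
      (fun j : (Σ n : {n : Fin r → ℤ // emb n ∈ latticeOf ℳ}, Fin (f ⟨emb n.1, n.2⟩)) =>
        j.1.1) := by
  let g : (Σ n : {n : Fin r → ℤ // emb n ∈ latticeOf ℳ}, Fin (f ⟨emb n.1, n.2⟩)) →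
      Σ l : latticeOf ℳ, Fin (f l) := fun j => ⟨⟨emb j.1.1, j.1.2⟩, j.2⟩
  have hg : Function.Bijective g := by
    constructor
    · rintro ⟨⟨m, hm⟩, i⟩ ⟨⟨n, hn⟩, j⟩ h
      obtain ⟨h1, h2⟩ := Sigma.mk.inj_iff.1 h
      obtain rfl : m = n := emb_injective (Subtype.mk.inj h1)
      exact congrArg _ (eq_of_heq h2)
    · rintro ⟨⟨l, hl⟩, i⟩
      by_cases h : l ∈ Set.range (emb : (Fin r → ℤ) → _)
      · obtain ⟨n, rfl⟩ := h
        exact ⟨⟨⟨n, hl⟩, i⟩, rfl⟩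
      · exact (Fin.cast (hf ⟨l, hl⟩ h) i).elim0
  refine isGradedFree_of_iso _ ((Functor.isoWhiskerLeft _ e).trans ?_)
  exact (unzipFreeIso ℳ _ (fun j : (Σ l : latticeOf ℳ, Fin (f l)) => j.1)
    (Equiv.ofBijective g hg) fun _ => rfl).symm

theorem monomial_mem_span_X {w : Fin r →₀ ℕ} (h : w ≠ 0) :
    MvPolynomial.monomial w (1 : k) ∈
      Ideal.span (Set.range (MvPolynomial.X : Fin r → MvPolynomial (Fin r) k)) := by
  obtain ⟨i, hi⟩ := Finsupp.ne_iff.1 h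
  rw [← Set.image_univ, MvPolynomial.mem_ideal_span_X_image]
  intro m hm
  rw [Finset.mem_singleton.1 (MvPolynomial.support_monomial_subset hm)]
  exact ⟨i, trivial, hi⟩

theorem monomial_smul_unzipIncl (F : latticeOf ℳ ⥤ ModuleCat.{u} k) (w : Fin r →₀ ℕ)
    {m n : Fin r → ℤ} (e : m + monDeg w = n) (h : m ≤ n) (v : F.obj (anchorOf ℳ m)) :
    MvPolynomial.monomial w (1 : k) • unzipIncl ℳ F m v =
      unzipIncl ℳ F n ((F.map (homOfLE (anchorOf_mono ℳ h))).hom v) :=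
  GradedOf.monomial_smul_incl (V := unzip ℳ F) w e h v

/-- Non-generators of `F` are contained in `(x_1, …, x_r)` times the unzipping of `F`. -/
theorem incl_mem_of_mem_lowerPart (F : latticeOf ℳ ⥤ ModuleCat.{u} k)
    (hF : ∀ l : latticeOf ℳ, (l : Fin r → WithBot ℤ) ∉ Set.range emb → Subsingleton (F.obj l))
    (n : Fin r → ℤ) {v : F.obj (anchorOf ℳ n)}
    (hv : v ∈ lowerPart F (anchorOf ℳ n)) :
    unzipIncl ℳ F n v ∈
      Ideal.span (Set.range (MvPolynomial.X : Fin r → MvPolynomial (Fin r) k)) •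
        (⊤ : Submodule (MvPolynomial (Fin r) k) (GradedOf (unzip ℳ F))) := by
  suffices h : lowerPart F (anchorOf ℳ n) ≤
      ((Ideal.span (Set.range (MvPolynomial.X : Fin r → MvPolynomial (Fin r) k)) •
        (⊤ : Submodule (MvPolynomial (Fin r) k) (GradedOf (unzip ℳ F)))).restrictScalars k).comap
          (unzipIncl ℳ F n) from h hv
  refine lowerPart_le F fun l hl v => ?_
  rw [Submodule.mem_comap]
  by_cases hr : (l : Fin r → WithBot ℤ) ∈ Set.range emb
  · obtain ⟨m, hm⟩ := hr
    have hmn : m ≤ n := emb_le.1 (hm ▸ le_trans hl.le (anchorOf_le ℳ n))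
    have hne : m ≠ n := by
      rintro rfl
      refine hl.not_ge ?_
      change (anchorOf ℳ m : Fin r → WithBot ℤ) ≤ l
      rw [← hm]
      exact anchorOf_le ℳ m
    -- The map from `l` to A(n) factors through A(m), so the image of `v` is x^{n-m} times an
    -- element of degree `m`, with `n - m ≠ 0`.
    have hlm : l ≤ anchorOf ℳ m := (le_anchorOf_iff ℳ).2 hm.ge
    have hw : expo (emb m) (emb n) ≠ 0 := fun h0 => hne <| by
      rw [← monDeg_expo hmn, h0, monDeg_zero, add_zero]
    have key := monomial_smul_unzipIncl ℳ F (expo (emb m) (emb n)) (monDeg_expo hmn) hmn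
      ((F.map (homOfLE hlm)).hom v)
    rw [map_map_apply F (homOfLE hlm) _ (homOfLE hl.le)] at key
    rw [← key, Submodule.restrictScalars_mem]
    exact Submodule.smul_mem_smul (monomial_mem_span_X hw) Submodule.mem_top
  · have := hF l hr
    rw [Subsingleton.elim v 0, map_zero, map_zero]
    exact zero_mem _

theorem range_map_unzipMap_le {F G : latticeOf ℳ ⥤ ModuleCat.{u} k} (φ : F ⟶ G)
    (hG : ∀ l : latticeOf ℳ, (l : Fin r → WithBot ℤ) ∉ Set.range emb → Subsingleton (G.obj l))
    (hφ : ∀ l, LinearMap.range (φ.app l).hom ≤ lowerPart G l) :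
    LinearMap.range (GradedOf.map (unzipMap ℳ φ)) ≤
      Ideal.span (Set.range (MvPolynomial.X : Fin r → MvPolynomial (Fin r) k)) •
        (⊤ : Submodule (MvPolynomial (Fin r) k) (GradedOf (unzip ℳ G))) := by
  rintro _ ⟨x, rfl⟩
  rw [← Submodule.mem_toAddSubmonoid]
  refine GradedOf.mem_of_proj_mem fun n => ?_
  rw [GradedOf.proj_map]
  exact incl_mem_of_mem_lowerPart ℳ G hG n (hφ _ ⟨GradedOf.proj (unzip ℳ F) n x, rfl⟩)

theorem subsingleton_gradedOf {V : (Fin r → ℤ) ⥤ ModuleCat.{u} k}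
    (h : ∀ n, Subsingleton (V.obj n)) : Subsingleton (GradedOf V) :=
  ⟨fun _ _ => GradedOf.ext_proj fun n => (h n).elim _ _⟩

theorem subsingleton_zip {l : latticeOf ℳ} (hl : (l : Fin r → WithBot ℤ) ∉ Set.range emb) :
    ∀ y ≤ l, Subsingleton ((zip ℳ).obj y) := fun y hy => by
  change Subsingleton (extPart ℳ y)
  rw [extPart_infinitary ℳ fun ⟨m, hm⟩ => hl (eq_emb_of_emb_le (m := m) (hm ▸ hy))]
  infer_instance

end Unzip

end

end LcmResolution

/-! ### The main theorem -/

open LcmResolution in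
theorem mainTheorem5 {k : Type u} [Field k] (r : ℕ)
    {E : Type u} [AddCommGroup E] [Module k E] [Module (MvPolynomial (Fin r) k) E]
    [IsScalarTower k (MvPolynomial (Fin r) k) E] [Module.Finite (MvPolynomial (Fin r) k) E]
    (ℳ : (Fin r → ℤ) → Submodule k E) (hℳ : DirectSum.IsInternal ℳ)
    [SetLike.GradedSMul (polyPart k r) ℳ] :
    -- the free resolution of `zip E` exists
    (∃ (F : ℕ → (latticeOf ℳ ⥤ ModuleCat.{u} k)) (d : ∀ i, F (i + 1) ⟶ F i) (ε : F 0 ⟶ zip ℳ),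
      IsFreeResolution d ε) ∧
    -- and, however it is chosen, its unzipping is a minimal graded free resolution of `E`, with
    -- `unzip (F i) ≅ ⨁ n, S(-n)^{f^i_n}`
    ∀ (F : ℕ → (latticeOf ℳ ⥤ ModuleCat.{u} k)) (d : ∀ i, F (i + 1) ⟶ F i) (ε : F 0 ⟶ zip ℳ),
      IsFreeResolution d ε →
        IsMinimalGradedFreeResolution ℳ (M := fun i => GradedOf (unzip ℳ (F i)))
          (fun i => GradedOf.part (unzip ℳ (F i)))
          (fun i => GradedOf.map (unzipMap ℳ (d i))) (unzipAug ℳ ε) ∧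
        (∀ i, IsGradedFree (GradedOf.part (unzip ℳ (F i)))
          (fun j : (Σ n : {n : Fin r → ℤ // emb n ∈ latticeOf ℳ},
            Fin (multiplicity d ε i ⟨emb n.1, n.2⟩)) => j.1.1)) ∧
        (∀ i (l : latticeOf ℳ), (l : Fin r → WithBot ℤ) ∉ Set.range emb →
          multiplicity d ε i l = 0) := by
  have hreal := realize_bijective ℳ hℳ
  have hfin : Module.Finite (MvPolynomial (Fin r) k) (GradedOf (emb_mono.functor ⋙ repOf ℳ)) :=
    Module.Finite.equiv (LinearEquiv.ofBijective (realize ℳ) hreal).symm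
  obtain ⟨lo, hi, hV⟩ := exists_isBoundedBy ℳ
  have hL : Finite (latticeOf ℳ) := hV.finite_lcmLattice
  have hunzip : ∀ n, Function.Bijective ((unzipZip ℳ).app n).hom := fun n =>
    (ConcreteCategory.isIso_iff_bijective _).1 (hV.isIso_map_anchor n)
  -- The augmentation is the unzipped `ε` followed by this bijection from unzip(zip E) to E, so its
  -- surjectivity and exactness can be tested on unzip(zip E).
  have hinj : Function.Injective (realize ℳ ∘ₗ GradedOf.map (unzipZip ℳ)) :=
    hreal.1.comp (GradedOf.map_injective _ fun n => (hunzip n).1)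
  have hsurj : Function.Surjective (realize ℳ ∘ₗ GradedOf.map (unzipZip ℳ)) :=
    hreal.2.comp (GradedOf.map_surjective _ fun n => (hunzip n).2)
  refine ⟨exists_isFreeResolution (zip ℳ) fun l => ?_, fun F d ε h => ?_⟩
  · by_cases hl : (l : Fin r → WithBot ℤ) ∈ Set.range emb
    · obtain ⟨n, hn⟩ := hl
      have := finite_obj (emb_mono.functor ⋙ repOf ℳ) n
      change Module.Finite k ((repOf ℳ).obj l)
      rw [← hn]
      exact this
    · have := subsingleton_zip ℳ hl l le_rfl
      infer_instance
  have hmult : ∀ i (l : latticeOf ℳ), (l : Fin r → WithBot ℤ) ∉ Set.range emb →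
      multiplicity d ε i l = 0 := fun i l hl => h.multiplicity_eq_zero (subsingleton_zip ℳ hl) i
  have hfree : ∀ i, IsGradedFree (GradedOf.part (unzip ℳ (F i)))
      (fun j : (Σ n : {n : Fin r → ℤ // emb n ∈ latticeOf ℳ},
        Fin (multiplicity d ε i ⟨emb n.1, n.2⟩)) => j.1.1) := fun i =>
    (h.free i).elim fun e => isGradedFree_unzip ℳ e (hmult i)
  refine ⟨?_, hfree, hmult⟩
  have hexact : Function.Exact (GradedOf.map (unzipMap ℳ (d 0)))
      (GradedOf.map (unzipMap ℳ ε)) := GradedOf.map_exact _ _ fun n => h.exact_zero _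
  exact
    { surjective := hsurj.comp (GradedOf.map_surjective _ fun n => h.surjective _)
      exact_zero := fun x => by
        rw [← hexact x]
        exact map_eq_zero_iff (realize ℳ ∘ₗ GradedOf.map (unzipZip ℳ)) hinj
      exact_succ := fun i => GradedOf.map_exact _ _ fun n => h.exact_succ i _
      degree_aug := fun n x hx => by
        obtain ⟨v, hv⟩ := GradedOf.map_mem_part (unzipZip ℳ)
          (GradedOf.map_mem_part (unzipMap ℳ ε) hx)
        change realize ℳ (GradedOf.map (unzipZip ℳ) (GradedOf.map (unzipMap ℳ ε) x)) ∈ ℳ n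
        rw [← hv]
        erw [realize_incl]
        rw [← extPart_emb ℳ n]
        exact v.2
      degree_diff := fun i n x hx => GradedOf.map_mem_part _ hx
      free := fun i => by
        have : Finite {n : Fin r → ℤ // emb n ∈ latticeOf ℳ} :=
          Finite.of_injective (fun n => (⟨emb n.1, n.2⟩ : latticeOf ℳ))
            fun m n hmn => Subtype.ext (emb_injective (Subtype.mk.inj hmn))
        exact ⟨_, _, (hfree i).reindex (Finite.equivFin _).symm⟩
      minimal := fun i => range_map_unzipMap_le ℳ (d i)
        (fun l hl => (h.subsingleton_of_le (subsingleton_zip ℳ hl) i l le_rfl).2)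
        (h.range_le_lowerPart i)
      bounded := ⟨Nat.card (latticeOf ℳ), fun i hi =>
        subsingleton_gradedOf fun n => h.subsingleton_of_card_lt hi _⟩ }
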